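/- **Setting.** Let $(\Theta,\mathcal E)$ and $(\mathsf Z,\mathcal Z)$ be measurable spaces with $\sigma$-finite reference measures ${\rm d}\theta$ and ${\rm d}z$, and let $\pi$ be a probability distribution on $\Theta\times\mathsf Z$ with joint density $\pi(\theta,z)$. Let $q(\theta,\cdot)$ be a Markov kernel on $\Theta$ with density $q(\theta,\theta')$ with respect to ${\rm d}\theta'$. Let $T\ge 0$, $N\ge 1$. For all $\theta,\theta'\in\Theta$ let: * $f_{\theta,\theta',t}:\mathsf Z\to[0,\infty)$, $t=0,\dots,T+1$, be unnormalised densities ($0<\int f_{\theta,\theta',t}\,{\rm d}z<\infty$) such that $f_{\theta,\theta',t}$ and $f_{\theta,\theta',t+1}$ have the same support for $t=0,\dots,T$, $f_{\theta,\theta',t}=f_{\theta',\theta,T+1-t}$ for $t=1,\dots,T$, $f_{\theta,\theta',0}(z)=\pi(\theta,z)$ and $f_{\theta,\theta',T+1}(z)=\pi(\theta',z)$; * $R_{\theta,\theta',t}$, $t=1,\dots,T$, be Markov kernels on $\mathsf Z$, $R_{\theta,\theta',t}$ being reversible with respect to the distribution with density proportional to $f_{\theta,\theta',t}$, and $R_{\theta,\theta',t}=R_{\theta',\theta,T+1-t}$;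 * $R_\theta$ be a Markov kernel on $\mathsf Z$, reversible with respect to $\pi_\theta({\rm d}z)\propto\pi(\theta,z)\,{\rm d}z$ (all jointly measurable in the parameters). Write $w_{\theta,\theta',t}=f_{\theta,\theta',t+1}/f_{\theta,\theta',t}$. For particles $\zeta=u_{0:T}^{(1:N)}\in\mathsf Z^{N(T+1)}$ put $$\hat C_{\theta,\theta'}(\zeta)=\prod_{t=0}^{T}\frac1N\sum_{i=1}^N w_{\theta,\theta',t}(u_t^{(i)}),\qquad \mathring r_\zeta(\theta,\theta')=\frac{q(\theta',\theta)}{q(\theta,\theta')}\,\hat C_{\theta,\theta'}(\zeta).$$ *SMC.* $\psi_{\theta,\theta',z}$ is the law of $\zeta$ when $u_0^{(i)}\sim R_\theta(z,\cdot)$ independently for $i=1,\dots,N$ and, for $t=1,\dots,T$, given the previous generations, independently for $i=1,\dots,N$, $$u_t^{(i)}\sim\sum_{j=1}^N\frac{w_{\theta,\theta',t-1}(u_{t-1}^{(j)})}{\sum_{l=1}^N w_{\theta,\theta',t-1}(u_{t-1}^{(l)})}\,R_{\theta,\theta',t}(u_{t-1}^{(j)},\cdot).$$ *Conditional SMC.*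 For a path $u=(u_0,\dots,u_T)$ and labels $\mathbf b\in\{1,\dots,N\}^{T+1}$, $\Phi^{\mathbf b}_{\theta,\theta',z}(u,\cdot)$ is the law of $\zeta$ when $u_t^{(b_t)}=u_t$ for all $t$ and all the other particles are drawn as in the SMC. *Proposals.* Given $x=(\theta,z)$, both proposals draw $\theta'\sim q(\theta,\cdot)$ and return $y=(\theta',z')$ and $\zeta$. * $Q_1(x,{\rm d}(y,\zeta))$: draw $\zeta\sim\psi_{\theta,\theta',z}$, then $k$ with probability proportional to $w_{\theta,\theta',T}(u_T^{(k)})$, then $z'\sim R_{\theta'}(u_T^{(k)},\cdot)$. * $Q_2^{\mathbf b}(x,{\rm d}(y,\zeta))$: draw the reversed path $u_T\sim R_\theta(z,\cdot)$, $u_{t-1}\sim R_{\theta',\theta,t}(u_t,\cdot)$ for $t=T,\dots,1$, then $z'\sim R_{\theta'}(u_0,\cdot)$, then $\zeta\sim\Phi^{\mathbf b}_{\theta',\theta,z'}(u,\cdot)$. *Algorithm.* At $x=(\theta,z)$, with probability $1/2$ draw $(y,\zeta)$ from $Q_1(x,\cdot)$ and move to $y$ with probability $\min\{1,\mathring r_\zeta(\theta,\theta')\}$,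 and with probability $1/2$ draw $(y,\zeta)$ from $Q_2^{(1,\dots,1)}(x,\cdot)$ and move to $y$ with probability $\min\{1,1/\mathring r_\zeta(\theta',\theta)\}$; when the move is rejected, stay at $x$. **Theorem.** The transition kernel of this algorithm satisfies detailed balance with respect to $\pi$. Moreover, $\mathring r_\zeta$ is the acceptance ratio of the pair $(Q_1,Q_2)$, where $Q_2=N^{-(T+1)}\sum_{\mathbf b}Q_2^{\mathbf b}$: on the set of all $(x,y,\zeta)$ with $q(\theta,\theta')>0$ and $q(\theta',\theta)>0$, $$\pi({\rm d}y)\,Q_2(y,{\rm d}(x,\zeta))=\frac{q(\theta',\theta)}{q(\theta,\theta')}\,\hat C_{\theta,\theta'}(\zeta)\;\pi({\rm d}x)\,Q_1(x,{\rm d}(y,\zeta)).$$ -/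

import Mathlib

open MeasureTheory ProbabilityTheory
open scoped ENNReal NNReal

namespace ParticleAIS

noncomputable section

/-! ### Elementary Markov kernels -/

section Basic

variable {α β ι : Type*} [MeasurableSpace α] [MeasurableSpace β] [Fintype ι]

instance (p : Prop) [Decidable p] (κ η : Kernel α β) [IsMarkovKernel κ] [IsMarkovKernel η] :
    IsMarkovKernel (if p then κ else η) := by
  split_ifs <;> infer_instance

/-- The finite mixture `a ↦ ∑ j, W j a • κ j a`: draw `j` with probability `W j a`, then draw from
`κ j a`. -/
def mixture (W : ι → α → ℝ≥0∞) (hW : ∀ j, Measurable (W j)) (κ : ι → Kernel α β) :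
    Kernel α β where
  toFun a := ∑ j, W j a • κ j a
  measurable' := by
    refine Measure.measurable_of_measurable_coe _ fun s hs => ?_
    simp only [Measure.coe_finsetSum, Finset.sum_apply, Measure.smul_apply, smul_eq_mul]
    exact Finset.measurable_sum _ fun j _ => (hW j).mul ((κ j).measurable_coe hs)

lemma isMarkovKernel_mixture (W : ι → α → ℝ≥0∞) (hW : ∀ j, Measurable (W j))
    (κ : ι → Kernel α β) [∀ j, IsMarkovKernel (κ j)] (h1 : ∀ a, ∑ j, W j a = 1) :
    IsMarkovKernel (mixture W hW κ) where
  isProbabilityMeasure a := ⟨by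
    change (∑ j, W j a • κ j a) Set.univ = 1
    simp [h1]⟩

/-- The product kernel `a ↦ ⨂ i, κ i a`: independent draws given `a`. -/
def independent (κ : ι → Kernel α β) [∀ i, IsMarkovKernel (κ i)] : Kernel α (ι → β) where
  toFun a := Measure.pi fun i => κ i a
  measurable' := by
    refine Measurable.measure_of_isPiSystem_of_isProbabilityMeasure
      generateFrom_pi.symm isPiSystem_pi ?_
    rintro _ ⟨s, hs, rfl⟩
    have hs' : ∀ i, MeasurableSet (s i) := fun i => hs i (Set.mem_univ i)
    simp only [Measure.pi_pi]
    exact Finset.measurable_prod _ fun i _ => (κ i).measurable_coe (hs' i)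

instance (κ : ι → Kernel α β) [∀ i, IsMarkovKernel (κ i)] : IsMarkovKernel (independent κ) where
  isProbabilityMeasure a := by
    change IsProbabilityMeasure (Measure.pi fun i => κ i a)
    infer_instance

lemma measurable_snoc (n : ℕ) :
    Measurable fun p : (Fin (n + 1) → β) × β =>
      (Fin.snoc (α := fun _ => β) p.1 p.2 : Fin (n + 2) → β) := by
  refine measurable_pi_iff.mpr fun i => ?_
  refine Fin.lastCases ?_ (fun j => ?_) i
  · simpa using measurable_snd
  · simp only [Fin.snoc_castSucc]
    exact (measurable_pi_apply j).comp measurable_fst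

/-- The law of the path `(e 0, …, e n)` of the Markov chain with `e 0 ∼ K₀ a` and
`e (s + 1) ∼ K s (a, e s)`. -/
def pathLaw (K₀ : Kernel α β) (K : ℕ → Kernel (α × β) β) :
    (n : ℕ) → Kernel α (Fin (n + 1) → β)
  | 0 => K₀.map fun e _ => e
  | n + 1 =>
    (pathLaw K₀ K n ⊗ₖ (K n).comap (fun p : α × (Fin (n + 1) → β) => (p.1, p.2 (Fin.last n)))
      (by fun_prop)).map fun p => Fin.snoc (α := fun _ => β) p.1 p.2

instance (K₀ : Kernel α β) (K : ℕ → Kernel (α × β) β) [IsMarkovKernel K₀]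
    [∀ n, IsMarkovKernel (K n)] (n : ℕ) : IsMarkovKernel (pathLaw K₀ K n) := by
  induction n with
  | zero => exact Kernel.IsMarkovKernel.map _ (by fun_prop)
  | succ n ih => exact Kernel.IsMarkovKernel.map _ (measurable_snoc n)

end Basic

/-- The probabilities of the distribution on `Fin N` with `ℙ(i) ∝ w i`
(uniform, by convention, when all weights vanish). -/
def normWeight {N : ℕ} (w : Fin N → ℝ≥0) (i : Fin N) : ℝ≥0∞ :=
  if ∑ j, w j = 0 then (N : ℝ≥0∞)⁻¹ else ((w i / ∑ j, w j : ℝ≥0) : ℝ≥0∞)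

lemma sum_normWeight {N : ℕ} [NeZero N] (w : Fin N → ℝ≥0) : ∑ i, normWeight w i = 1 := by
  by_cases h : ∑ j, w j = 0
  · simp only [normWeight, h, if_true, Finset.sum_const, Finset.card_univ, Fintype.card_fin,
      nsmul_eq_mul]
    exact ENNReal.mul_inv_cancel (by exact_mod_cast NeZero.ne N) (by simp)
  · simp only [normWeight, h, if_false]
    rw [← ENNReal.ofNNReal_finsetSum, ← Finset.sum_div, div_self h, ENNReal.coe_one]

lemma measurable_normWeight {N : ℕ} (i : Fin N) :
    Measurable fun w : Fin N → ℝ≥0 => normWeight w i := by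
  unfold normWeight
  refine Measurable.ite ?_ measurable_const ?_
  · exact measurableSet_eq_fun (by fun_prop) measurable_const
  · fun_prop

/-- The probability distribution with density proportional to `f`, when `0 < ∫ f dν < ∞`. -/
def normalisedLaw {Z : Type*} [MeasurableSpace Z] (ν : Measure Z) (f : Z → ℝ≥0) : Measure Z :=
  (∫⁻ z, f z ∂ν)⁻¹ • ν.withDensity fun z => (f z : ℝ≥0∞)

/-! ### The latent variable model and its annealing schedule -/

/-- A latent variable model on `Θ × Z`, with reference measures `m` on `Θ` and `ν` on `Z`, together
with a proposal for the parameter and an annealing schedule with `T` intermediate steps.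
Only `f t` for `t ≤ T + 1` and `R t` for `1 ≤ t ≤ T` matter. -/
structure AnnealedModel {Θ Z : Type*} [MeasurableSpace Θ] [MeasurableSpace Z]
    (m : Measure Θ) (ν : Measure Z) (T : ℕ) where
  /-- the joint density `π(θ, z)` -/
  dens : Θ → Z → ℝ≥0
  measurable_dens : Measurable fun p : Θ × Z => dens p.1 p.2
  lintegral_dens : ∫⁻ p, dens p.1 p.2 ∂(m.prod ν) = 1
  /-- the density `q(θ, θ')` of the parameter proposal -/
  qDens : Θ → Θ → ℝ≥0
  measurable_qDens : Measurable fun p : Θ × Θ => qDens p.1 p.2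
  /-- the parameter proposal kernel `q(θ, dθ')` -/
  q : Kernel Θ Θ
  markov_q : IsMarkovKernel q
  q_eq : ∀ θ, q θ = m.withDensity fun η => (qDens θ η : ℝ≥0∞)
  /-- the unnormalised densities `f_{θ, θ', t}(z)` -/
  f : ℕ → Θ → Θ → Z → ℝ≥0
  measurable_f : ∀ t, Measurable fun p : Θ × Θ × Z => f t p.1 p.2.1 p.2.2
  f_mass_pos : ∀ t ≤ T + 1, ∀ θ η, ∫⁻ z, f t θ η z ∂ν ≠ 0
  f_mass_finite : ∀ t ≤ T + 1, ∀ θ η, ∫⁻ z, f t θ η z ∂ν ≠ ∞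
  f_support : ∀ t ≤ T, ∀ θ η z, f t θ η z ≠ 0 ↔ f (t + 1) θ η z ≠ 0
  f_symm : ∀ t, 1 ≤ t → t ≤ T → ∀ θ η z, f t θ η z = f (T + 1 - t) η θ z
  f_zero : ∀ θ η z, f 0 θ η z = dens θ z
  f_last : ∀ θ η z, f (T + 1) θ η z = dens η z
  /-- the intermediate kernels `R_{θ, θ', t}(z, dz')` -/
  R : ℕ → Kernel (Θ × Θ × Z) Z
  markov_R : ∀ t, IsMarkovKernel (R t)
  R_reversible : ∀ t, 1 ≤ t → t ≤ T → ∀ θ η,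
    ((R t).comap (fun z => (θ, η, z)) (by fun_prop)).IsReversible (normalisedLaw ν (f t θ η))
  R_symm : ∀ t, 1 ≤ t → t ≤ T → ∀ θ η z, R t (θ, η, z) = R (T + 1 - t) (η, θ, z)
  /-- the kernels `R_θ(z, dz')` -/
  R₀ : Kernel (Θ × Z) Z
  markov_R₀ : IsMarkovKernel R₀
  R₀_reversible : ∀ θ,
    (R₀.comap (fun z => (θ, z)) (by fun_prop)).IsReversible (normalisedLaw ν (dens θ))

namespace AnnealedModel

variable {Θ Z : Type*} [MeasurableSpace Θ] [MeasurableSpace Z] {m : Measure Θ} {ν : Measure Z}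
  {T : ℕ} (M : AnnealedModel m ν T) (N : ℕ) [NeZero N]

instance : IsMarkovKernel M.q := M.markov_q
instance (t : ℕ) : IsMarkovKernel (M.R t) := M.markov_R t
instance : IsMarkovKernel M.R₀ := M.markov_R₀

/-- The target distribution `π(d(θ, z))`. -/
def target : Measure (Θ × Z) := (m.prod ν).withDensity fun p => (M.dens p.1 p.2 : ℝ≥0∞)

/-- The incremental weight `f_{θ, θ', t + 1}(u) / f_{θ, θ', t}(u)`. -/
def weight (t : ℕ) (θ η : Θ) (u : Z) : ℝ≥0 := M.f (t + 1) θ η u / M.f t θ η u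

lemma measurable_weight (t : ℕ) :
    Measurable fun p : Θ × Θ × Z => M.weight t p.1 p.2.1 p.2.2 :=
  (M.measurable_f (t + 1)).div (M.measurable_f t)

/-! ### The interacting particle system

A triple `(θ, θ', z) : Θ × Θ × Z` indexes the SMC sampler moving from `θ` to `θ'` and started
from `z`. The particles are `ζ : Fin (T + 1) → Fin N → Z`, with `ζ t i` for `u_t^{(i)}`. -/

/-- Initial move of one particle: `R_θ(z, ·)`. -/
def initMove : Kernel (Θ × Θ × Z) Z :=
  M.R₀.comap (fun a : Θ × Θ × Z => (a.1, a.2.2)) (by fun_prop)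

instance : IsMarkovKernel M.initMove := by unfold initMove; infer_instance

/-- Resample-and-move step of one particle from time `s` to time `s + 1`, given the generation `e`
at time `s`: draw `j` with probability proportional to the weights of time `s` and then draw
from `R_{θ, θ', s + 1}(e j, ·)`. -/
def move (s : ℕ) : Kernel ((Θ × Θ × Z) × (Fin N → Z)) Z :=
  mixture (fun j p => normWeight (fun i => M.weight s p.1.1 p.1.2.1 (p.2 i)) j)
    (fun j => (measurable_normWeight j).comp <| measurable_pi_iff.mpr fun i =>
      (M.measurable_weight s).comp
        (f := fun p : (Θ × Θ × Z) × (Fin N → Z) => (p.1.1, p.1.2.1, p.2 i)) (by fun_prop))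
    fun j => (M.R (s + 1)).comap
      (fun p : (Θ × Θ × Z) × (Fin N → Z) => (p.1.1, p.1.2.1, p.2 j)) (by fun_prop)

instance (s : ℕ) : IsMarkovKernel (M.move N s) :=
  isMarkovKernel_mixture _ _ _ fun _ => sum_normWeight _

/-- The law `ψ_{θ, θ', z}` of all the particles of the SMC sampler, ancestors integrated out. -/
def smc : Kernel (Θ × Θ × Z) (Fin (T + 1) → Fin N → Z) :=
  pathLaw (independent fun _ : Fin N => M.initMove)
    (fun s => independent fun _ : Fin N => M.move N s) T

/-- The conditional SMC kernel: the particles given that the path `u` is carried at time `t` by the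
particle with label `b t`; all the other particles are drawn as in `smc`. -/
def csmc (b : Fin (T + 1) → Fin N) :
    Kernel ((Θ × Θ × Z) × (Fin (T + 1) → Z)) (Fin (T + 1) → Fin N → Z) :=
  pathLaw
    (independent fun i : Fin N =>
      if i = b 0 then
        Kernel.deterministic (fun a : (Θ × Θ × Z) × (Fin (T + 1) → Z) => a.2 0) (by fun_prop)
      else M.initMove.comap Prod.fst measurable_fst)
    (fun s => independent fun i : Fin N =>
      if i = b (Fin.ofNat (T + 1) (s + 1)) then
        Kernel.deterministic
          (fun p : ((Θ × Θ × Z) × (Fin (T + 1) → Z)) × (Fin N → Z) =>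
            p.1.2 (Fin.ofNat (T + 1) (s + 1))) (by fun_prop)
      else (M.move N s).comap
        (fun p : ((Θ × Θ × Z) × (Fin (T + 1) → Z)) × (Fin N → Z) => (p.1.1, p.2)) (by fun_prop))
    T

/-- The law of the reversed path: given `(θ, θ', z)`, draw `u_T ∼ R_θ(z, ·)` and then
`u_{t-1} ∼ R_{θ', θ, t}(u_t, ·)` for `t = T, …, 1`. The chain below generates
`u_T, u_{T-1}, …, u_0`, and the result is put back in the order `u_0, …, u_T`. -/
def reversedPath : Kernel (Θ × Θ × Z) (Fin (T + 1) → Z) :=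
  (pathLaw M.initMove
    (fun s => (M.R (T - s)).comap
      (fun p : (Θ × Θ × Z) × Z => (p.1.2.1, p.1.1, p.2)) (by fun_prop)) T).map
    fun v t => v (Fin.rev t)

/-- Last move of the SMC sampler: draw `k` with probability proportional to the weights of time `T`
and then `z' ∼ R_{θ'}(u_T^{(k)}, ·)`. -/
def finalMove : Kernel ((Θ × Θ × Z) × (Fin (T + 1) → Fin N → Z)) Z :=
  mixture
    (fun k p => normWeight (fun i => M.weight T p.1.1 p.1.2.1 (p.2 (Fin.last T) i)) k)
    (fun k => (measurable_normWeight k).comp <| measurable_pi_iff.mpr fun i =>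
      (M.measurable_weight T).comp
        (f := fun p : (Θ × Θ × Z) × (Fin (T + 1) → Fin N → Z) =>
          (p.1.1, p.1.2.1, p.2 (Fin.last T) i)) (by fun_prop))
    fun k => M.R₀.comap
      (fun p : (Θ × Θ × Z) × (Fin (T + 1) → Fin N → Z) => (p.1.2.1, p.2 (Fin.last T) k))
      (by fun_prop)

instance : IsMarkovKernel (M.smc N) := by unfold smc; infer_instance

instance (b : Fin (T + 1) → Fin N) : IsMarkovKernel (M.csmc N b) := by
  unfold csmc; infer_instance

instance : IsMarkovKernel M.reversedPath := Kernel.IsMarkovKernel.map _ (by fun_prop)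

instance : IsMarkovKernel (M.finalMove N) :=
  isMarkovKernel_mixture _ _ _ fun _ => sum_normWeight _

/-! ### The two proposals -/

/-- The proposal `Q₁(x, d(y, ζ))`, for `x = (θ, z)` and `y = (θ', z')`:
`θ' ∼ q(θ, ·)`, `ζ ∼ ψ_{θ, θ', z}`, and then `z'` from `finalMove`. -/
def Q₁ : Kernel (Θ × Z) ((Θ × Z) × (Fin (T + 1) → Fin N → Z)) :=
  (M.q.comap Prod.fst measurable_fst
    ⊗ₖ (M.smc N).comap (fun p : (Θ × Z) × Θ => (p.1.1, p.2, p.1.2)) (by fun_prop)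
    ⊗ₖ (M.finalMove N).comap
      (fun p : (Θ × Z) × Θ × (Fin (T + 1) → Fin N → Z) => ((p.1.1, p.2.1, p.1.2), p.2.2))
      (by fun_prop)).map
    fun p => ((p.1.1, p.2), p.1.2)

/-- The proposal `Q₂(x, d(y, ζ))`, for `x = (θ, z)` and `y = (θ', z')`, with the retained path
labelled by `b`: `θ' ∼ q(θ, ·)`, `u` from `reversedPath` at `(θ, θ', z)`, `z' ∼ R_{θ'}(u_0, ·)`,
and `ζ` from the conditional SMC kernel at `(θ', θ, z')` given `u`. -/
def Q₂ (b : Fin (T + 1) → Fin N) :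
    Kernel (Θ × Z) ((Θ × Z) × (Fin (T + 1) → Fin N → Z)) :=
  (M.q.comap Prod.fst measurable_fst
    ⊗ₖ M.reversedPath.comap (fun p : (Θ × Z) × Θ => (p.1.1, p.2, p.1.2)) (by fun_prop)
    ⊗ₖ M.R₀.comap (fun p : (Θ × Z) × Θ × (Fin (T + 1) → Z) => (p.2.1, p.2.2 0)) (by fun_prop)
    ⊗ₖ (M.csmc N b).comap
      (fun p : (Θ × Z) × (Θ × (Fin (T + 1) → Z)) × Z =>
        ((p.2.1.1, p.1.1, p.2.2), p.2.1.2)) (by fun_prop)).map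
    fun p => ((p.1.1.1, p.1.2), p.2)

/-- `Q₂` with the labels of the retained path drawn uniformly at random. -/
def Q₂Uniform : Kernel (Θ × Z) ((Θ × Z) × (Fin (T + 1) → Fin N → Z)) :=
  mixture (fun (_ : Fin (T + 1) → Fin N) _ => ((N : ℝ≥0∞) ^ (T + 1))⁻¹)
    (fun _ => measurable_const) fun b => M.Q₂ N b

instance : IsMarkovKernel (M.Q₁ N) := Kernel.IsMarkovKernel.map _ (by fun_prop)

instance (b : Fin (T + 1) → Fin N) : IsMarkovKernel (M.Q₂ N b) :=
  Kernel.IsMarkovKernel.map _ (by fun_prop)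

instance : IsMarkovKernel (M.Q₂Uniform N) := isMarkovKernel_mixture _ _ _ fun _ => by
  simp only [Finset.sum_const, Finset.card_univ, Fintype.card_fun, Fintype.card_fin,
    nsmul_eq_mul, Nat.cast_pow]
  exact ENNReal.mul_inv_cancel (by simp [NeZero.ne N]) (by simp)

/-! ### Acceptance ratio and transition kernel -/

/-- The SMC normalising-constant estimate
`Ĉ_{θ, θ'}(ζ) = ∏_{t ≤ T} N⁻¹ ∑_i f_{θ, θ', t + 1}(ζ t i) / f_{θ, θ', t}(ζ t i)`. -/
def estimate {N : ℕ} (θ η : Θ) (ζ : Fin (T + 1) → Fin N → Z) : ℝ≥0∞ :=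
  ∏ t : Fin (T + 1), (N : ℝ≥0∞)⁻¹ * ∑ i : Fin N, (M.weight t θ η (ζ t i) : ℝ≥0∞)

/-- The acceptance ratio `(q(θ', θ) / q(θ, θ')) * Ĉ_{θ, θ'}(ζ)`. -/
def ratio {N : ℕ} (θ η : Θ) (ζ : Fin (T + 1) → Fin N → Z) : ℝ≥0∞ :=
  (M.qDens η θ : ℝ≥0∞) / (M.qDens θ η : ℝ≥0∞) * M.estimate θ η ζ

lemma measurable_ratio {α : Type*} [MeasurableSpace α] {N : ℕ} {g h : α → Θ}
    {ζ : α → Fin (T + 1) → Fin N → Z} (hg : Measurable g) (hh : Measurable h)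
    (hζ : Measurable ζ) : Measurable fun a => M.ratio (g a) (h a) (ζ a) := by
  unfold ratio estimate
  refine Measurable.mul (Measurable.div ?_ ?_)
    (Finset.measurable_prod _ fun t _ => Measurable.const_mul
      (Finset.measurable_sum _ fun i _ => ?_) _)
  · exact (M.measurable_qDens.comp (hh.prodMk hg)).coe_nnreal_ennreal
  · exact (M.measurable_qDens.comp (hg.prodMk hh)).coe_nnreal_ennreal
  · exact ((M.measurable_weight t).comp (hg.prodMk (hh.prodMk
      ((measurable_pi_apply i).comp ((measurable_pi_apply t).comp hζ))))).coe_nnreal_ennreal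

end AnnealedModel

/-- The accept-reject kernel with proposal `Q` and acceptance probability `α`:
`P(x, dy) = ∫ Q(x, d(y, u)) α(x, y, u) + ρ(x) δ_x(dy)`, `ρ(x) = 1 - ∫ Q(x, d(y, u)) α(x, y, u)`. -/
def acceptReject {X U : Type*} [MeasurableSpace X] [MeasurableSpace U] (Q : Kernel X (X × U))
    [IsMarkovKernel Q] (α : X × X × U → ℝ≥0∞) (hα : Measurable α) : Kernel X X where
  toFun x := ((Q x).withDensity fun p => α (x, p)).map Prod.fst +
    (1 - ∫⁻ p, α (x, p) ∂(Q x)) • Measure.dirac x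
  measurable' := by
    refine Measure.measurable_of_measurable_coe _ fun s hs => ?_
    simp only [Measure.add_apply, Measure.smul_apply, smul_eq_mul]
    refine Measurable.add ?_ (Measurable.mul ?_ ?_)
    · have h : ∀ x, (((Q x).withDensity fun p => α (x, p)).map Prod.fst) s
          = ∫⁻ p, (Prod.fst ⁻¹' s : Set (X × U)).indicator (fun p => α (x, p)) p ∂(Q x) := by
        intro x
        rw [Measure.map_apply measurable_fst hs, withDensity_apply _ (measurable_fst hs),
          lintegral_indicator (measurable_fst hs)]
      simp only [h]
      refine Measurable.lintegral_kernel_prod_right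
        (f := fun x p => (Prod.fst ⁻¹' s : Set (X × U)).indicator (fun p => α (x, p)) p) ?_
      exact hα.indicator (s := {a : X × X × U | a.2.1 ∈ s})
        ((measurable_fst.comp measurable_snd) hs)
    · exact measurable_const.sub (Measurable.lintegral_kernel_prod_right
        (f := fun x p => α (x, p)) hα)
    · exact (Measure.measurable_coe hs).comp Measure.measurable_dirac

lemma isMarkovKernel_acceptReject {X U : Type*} [MeasurableSpace X] [MeasurableSpace U]
    (Q : Kernel X (X × U)) [IsMarkovKernel Q] (α : X × X × U → ℝ≥0∞) (hα : Measurable α)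
    (h1 : ∀ a, α a ≤ 1) : IsMarkovKernel (acceptReject Q α hα) where
  isProbabilityMeasure x := ⟨by
    change (((Q x).withDensity fun p => α (x, p)).map Prod.fst +
      (1 - ∫⁻ p, α (x, p) ∂(Q x)) • Measure.dirac x) Set.univ = 1
    rw [Measure.add_apply, Measure.map_apply measurable_fst MeasurableSet.univ]
    simp only [Set.preimage_univ, withDensity_apply _ MeasurableSet.univ, Measure.restrict_univ,
      Measure.smul_apply, measure_univ, smul_eq_mul, mul_one]
    refine add_tsub_cancel_of_le ?_
    calc ∫⁻ p, α (x, p) ∂(Q x) ≤ ∫⁻ _, 1 ∂(Q x) := lintegral_mono fun p => h1 _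
      _ = 1 := by simp⟩

namespace AnnealedModel

variable {Θ Z : Type*} [MeasurableSpace Θ] [MeasurableSpace Z] {m : Measure Θ} {ν : Measure Z}
  {T : ℕ} (M : AnnealedModel m ν T) (N : ℕ) [NeZero N]

/-- The set of all `(x, y, ζ)` with `q(θ, θ') > 0` and `q(θ', θ) > 0`. -/
def proposable : Set ((Θ × Z) × (Θ × Z) × (Fin (T + 1) → Fin N → Z)) :=
  {p | M.qDens p.1.1 p.2.1.1 ≠ 0 ∧ M.qDens p.2.1.1 p.1.1 ≠ 0}

/-- The first update: propose `(y, ζ)` from `Q₁`, accept with probability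
`min {1, r_ζ(θ, θ')}`. -/
def update₁ : Kernel (Θ × Z) (Θ × Z) :=
  acceptReject (M.Q₁ N) (fun p => min 1 (M.ratio p.1.1 p.2.1.1 p.2.2))
    (measurable_const.min (M.measurable_ratio (by fun_prop) (by fun_prop) (by fun_prop)))

/-- The second update: propose `(y, ζ)` from `Q₂`, the retained path being the first particle at all
times, and accept with probability `min {1, 1 / r_ζ(θ', θ)}`. -/
def update₂ : Kernel (Θ × Z) (Θ × Z) :=
  acceptReject (M.Q₂ N fun _ => 0) (fun p => min 1 (1 / M.ratio p.2.1.1 p.1.1 p.2.2))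
    (measurable_const.min (measurable_const.div
      (M.measurable_ratio (by fun_prop) (by fun_prop) (by fun_prop))))

instance : IsMarkovKernel (M.update₁ N) :=
  isMarkovKernel_acceptReject _ _ _ fun _ => min_le_left _ _

instance : IsMarkovKernel (M.update₂ N) :=
  isMarkovKernel_acceptReject _ _ _ fun _ => min_le_left _ _

/-- The transition kernel of the algorithm: each of the two updates is applied with
probability `1 / 2`. -/
def transition : Kernel (Θ × Z) (Θ × Z) :=
  mixture (fun (_ : Fin 2) _ => 2⁻¹) (fun _ => measurable_const) ![M.update₁ N, M.update₂ N]

instance : IsMarkovKernel (M.transition N) := by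
  have : ∀ j, IsMarkovKernel ((![M.update₁ N, M.update₂ N] : Fin 2 → Kernel _ _) j) := by
    intro j
    fin_cases j
    · exact inferInstanceAs (IsMarkovKernel (M.update₁ N))
    · exact inferInstanceAs (IsMarkovKernel (M.update₂ N))
  exact isMarkovKernel_mixture _ _ _ fun _ => by 
    simpa using ENNReal.mul_inv_cancel (a := 2) (by simp) (by simp)

end AnnealedModel

end

end ParticleAIS

/-! Everything rests on one identity for fixed parameters `θ`, `η`. Weighted by the estimate `Ĉ`,
the SMC law started from the density `π(θ, ·)` and followed by the final move equals the uniform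
mixture over labels `b` of the law built from the other end: `z'` with density `π(η, ·)`, a reversed
path, `z`, then conditional SMC around that path. This is `lintegral_smc_estimate`, and it has two
halves.

Unrolling the particle system (`lintegral_smcUpTo`): each factor of `Ĉ` is a mean of weights, whose
sum cancels the denominator of the selection made at that time. What is left is a sum over the
selected particles of their bare weights. Particles of one generation are i.i.d. given the past, so
one of them can be singled out and the others drawn around it. The singled-out particles form an
annealed Markov chain carrying the product of its weights, and the others follow conditional SMC.

Reversing the retained path (`lintegral_reverse`): the weight at time `t` turns `f t` into `f (t +
1)`, and the kernel at time `t` is reversible for `f t`. Alternating the two facts carries the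
initial density to the final one while reversing the chain.

Inserting the proposal densities of the parameter gives the acceptance ratio of `Q₁` and
`Q₂Uniform`. The algorithm uses one fixed labelling instead, but acceptance depends on `ζ` only
through `Ĉ`, which ignores the order within each generation, so all labellings give the same
accepted moves (`lintegral_Q₂_of_symmetric`). With the usual Metropolis identity, accepted moves of
the first update are the reversals of those of the second (`lintegral_accepted`), and the equal
mixture of the two is reversible. -/

namespace ParticleAIS

/-! ### Integration against mixtures, path laws and product laws. -/

section Generic

variable {α α' β γ ι : Type*} [MeasurableSpace α] [MeasurableSpace α'] [MeasurableSpace β]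
  [MeasurableSpace γ]

-- Iterated kernel integrals whose kernels depend on outer variables occur in every identity below;
-- this rule lets `fun_prop` settle their measurability.
@[fun_prop]
lemma measurable_lintegral_comp {κ : Kernel β γ} [IsSFiniteKernel κ] {g : α → β}
    (hg : Measurable g) {F : α → γ → ℝ≥0∞} (hF : Measurable (Function.uncurry F)) :
    Measurable fun a => ∫⁻ v, F a v ∂(κ (g a)) :=
  Measurable.lintegral_kernel_prod_right (κ := κ.comap g hg) hF

@[fun_prop]
lemma measurable_finSnoc {n : ℕ} {f : α → Fin (n + 1) → β} {g : α → β}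
    (hf : Measurable f) (hg : Measurable g) :
    Measurable fun a => (Fin.snoc (α := fun _ => β) (f a) (g a) : Fin (n + 2) → β) :=
  (measurable_snoc n).comp (hf.prodMk hg)

@[fun_prop]
lemma measurable_finCons {n : ℕ} {f : α → Fin (n + 1) → β} {g : α → β}
    (hf : Measurable f) (hg : Measurable g) :
    Measurable fun a => (Fin.cons (α := fun _ => β) (g a) (f a) : Fin (n + 2) → β) := by
  refine measurable_pi_iff.mpr fun i => ?_
  refine Fin.cases ?_ (fun j => ?_) i
  · simpa using hg
  · simp only [Fin.cons_succ]; exact (measurable_pi_apply j).comp hf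

lemma lintegral_mixture [Fintype ι] (W : ι → α → ℝ≥0∞) (hW : ∀ j, Measurable (W j))
    (κ : ι → Kernel α β) (a : α) (F : β → ℝ≥0∞) :
    ∫⁻ x, F x ∂(mixture W hW κ a) = ∑ j, W j a * ∫⁻ x, F x ∂(κ j a) := by
  change ∫⁻ x, F x ∂(∑ j, W j a • κ j a) = _
  rw [lintegral_finsetSum_measure]
  simp

lemma independent_apply [Fintype ι] (κ : ι → Kernel α β) [∀ i, IsMarkovKernel (κ i)] (a : α) :
    independent κ a = Measure.pi fun i => κ i a := rfl

lemma lintegral_pathLaw_zero (K₀ : Kernel α β) (K : ℕ → Kernel (α × β) β) (a : α)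
    {F : (Fin 1 → β) → ℝ≥0∞} (hF : Measurable F) :
    ∫⁻ u, F u ∂(pathLaw K₀ K 0 a) = ∫⁻ x, F (fun _ => x) ∂(K₀ a) := by
  rw [pathLaw, Kernel.lintegral_map _ (by fun_prop) _ hF]

section PathLaw

variable (K₀ : Kernel α β) (K : ℕ → Kernel (α × β) β) [IsMarkovKernel K₀]
  [∀ n, IsMarkovKernel (K n)]

lemma lintegral_pathLaw_succ (n : ℕ) (a : α) {F : (Fin (n + 2) → β) → ℝ≥0∞}
    (hF : Measurable F) :
    ∫⁻ u, F u ∂(pathLaw K₀ K (n + 1) a) =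
      ∫⁻ u, ∫⁻ x, F (Fin.snoc (α := fun _ => β) u x) ∂(K n (a, u (Fin.last n)))
        ∂(pathLaw K₀ K n a) := by
  rw [pathLaw, Kernel.lintegral_map _ (measurable_snoc n) _ hF,
    Kernel.lintegral_compProd _ _ _ (by fun_prop)]
  rfl

/-- Law of a path, conditioning on its first point. -/
lemma lintegral_pathLaw_cons (n : ℕ) (a : α) {F : (Fin (n + 2) → β) → ℝ≥0∞}
    (hF : Measurable F) :
    ∫⁻ u, F u ∂(pathLaw K₀ K (n + 1) a) =
      ∫⁻ x, ∫⁻ u, F (Fin.cons (α := fun _ => β) x u)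
        ∂(pathLaw (K 0) (fun s => (K (s + 1)).comap (fun p : (α × β) × β => (p.1.1, p.2))
          (by fun_prop)) n (a, x)) ∂(K₀ a) := by
  induction n with
  | zero =>
    rw [lintegral_pathLaw_succ _ _ _ _ hF, lintegral_pathLaw_zero]
    · refine lintegral_congr fun x => ?_
      rw [lintegral_pathLaw_zero _ _ _ (F := fun u => F (Fin.cons (α := fun _ => β) x u))
        (by fun_prop)]
      refine lintegral_congr fun y => congrArg F ?_
      ext i
      refine Fin.lastCases ?_ (fun j => ?_) i
      · rw [Fin.snoc_last]; rfl
      · rw [Fin.snoc_castSucc, Fin.fin_one_eq_zero j]; rfl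
    · exact measurable_lintegral_comp (by fun_prop) (by fun_prop)
  | succ n ih =>
    rw [lintegral_pathLaw_succ _ _ _ _ hF, ih]
    · refine lintegral_congr fun x => ?_
      rw [lintegral_pathLaw_succ _ _ _ _
        (F := fun u => F (Fin.cons (α := fun _ => β) x u))
        (by fun_prop)]
      refine lintegral_congr fun u => ?_
      rw [Kernel.comap_apply]
      refine lintegral_congr fun y => congrArg F ?_
      rw [Fin.cons_snoc_eq_snoc_cons]
    · exact measurable_lintegral_comp (by fun_prop) (by fun_prop)

/-- Path laws whose transitions are intertwined by maps of the state space. -/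
lemma lintegral_pathLaw_map (K₀' : Kernel α' γ) (K' : ℕ → Kernel (α' × γ) γ) [IsMarkovKernel K₀']
    [∀ n, IsMarkovKernel (K' n)] (a : α) (a' : α') (g : ℕ → β → γ) (hg : ∀ s, Measurable (g s))
    (h₀ : (K₀ a).map (g 0) = K₀' a') (n : ℕ)
    (h : ∀ s < n, ∀ x, (K s (a, x)).map (g (s + 1)) = K' s (a', g s x))
    {F : (Fin (n + 1) → γ) → ℝ≥0∞} (hF : Measurable F) :
    ∫⁻ u, F (fun t => g t (u t)) ∂(pathLaw K₀ K n a) = ∫⁻ u, F u ∂(pathLaw K₀' K' n a') := by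
  have hm : ∀ n, Measurable fun (u : Fin (n + 1) → β) (t : Fin (n + 1)) => g t (u t) := fun n =>
    measurable_pi_iff.mpr fun t => (hg t).comp (measurable_pi_apply t)
  induction n with
  | zero =>
    rw [lintegral_pathLaw_zero _ _ _ hF,
      lintegral_pathLaw_zero _ _ _ (F := fun u => F fun t => g t (u t)) (hF.comp (hm 0)), ← h₀,
      lintegral_map (f := fun x => F fun _ => x) (by fun_prop) (hg 0)]
    refine lintegral_congr fun x => congrArg F ?_
    ext t
    rw [Fin.fin_one_eq_zero t]; rfl
  | succ n ih =>
    rw [lintegral_pathLaw_succ _ _ _ _ hF,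
      lintegral_pathLaw_succ _ _ _ _ (F := fun u => F fun t => g t (u t)) (hF.comp (hm _)),
      ← ih fun s hs => h s (by omega)]
    · refine lintegral_congr fun u => ?_
      have h' := h n (by omega) (u (Fin.last n))
      simp only [Fin.val_last] at h' ⊢
      rw [← h', lintegral_map
        (f := fun x => F (Fin.snoc (α := fun _ => γ) (fun t : Fin (n + 1) => g t (u t)) x))
        (hF.comp (by fun_prop)) (hg _)]
      refine lintegral_congr fun x => congrArg F ?_
      ext t
      refine Fin.lastCases ?_ (fun j => ?_) t <;> simp
    · exact measurable_lintegral_comp (by fun_prop) (by fun_prop)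

lemma pathLaw_congr (K₀' : Kernel α' β) (K' : ℕ → Kernel (α' × β) β) [IsMarkovKernel K₀']
    [∀ n, IsMarkovKernel (K' n)] (a : α) (a' : α') (h₀ : K₀ a = K₀' a') (n : ℕ)
    (h : ∀ s < n, ∀ x, K s (a, x) = K' s (a', x)) :
    pathLaw K₀ K n a = pathLaw K₀' K' n a' := by
  refine Measure.ext_of_lintegral _ fun F hF => ?_
  exact lintegral_pathLaw_map K₀ K K₀' K' a a' (fun _ => id) (fun _ => measurable_id)
    (by simpa using h₀) n (by simpa using h) hF

end PathLaw

section Pi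

variable [Fintype ι] [DecidableEq ι] (μ : Measure β) [IsProbabilityMeasure μ]

lemma measurable_update_prod {ι : Type*} [DecidableEq ι] (k : ι) :
    Measurable fun p : β × (ι → β) => Function.update p.2 k p.1 := by
  refine measurable_pi_iff.mpr fun i => ?_
  by_cases h : i = k
  · subst h; simpa using measurable_fst
  · simpa [Function.update_of_ne h] using (by fun_prop : Measurable fun p : β × (ι → β) => p.2 i)

lemma pi_update_dirac (k : ι) (x : β) :
    (Measure.pi fun _ : ι => μ).map (fun e => Function.update e k x) =
      Measure.pi fun i => if i = k then Measure.dirac x else μ := by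
  have : ∀ i, IsProbabilityMeasure (if i = k then Measure.dirac x else μ) := fun i => by
    split_ifs <;> infer_instance
  refine (Measure.pi_eq fun s hs => ?_).symm
  have hm : Measurable fun e : ι → β => Function.update e k x :=
    (measurable_update_prod k).comp (by fun_prop : Measurable fun e : ι → β => (x, e))
  rw [Measure.map_apply hm (MeasurableSet.univ_pi hs)]
  have : (fun e : ι → β => Function.update e k x) ⁻¹' Set.univ.pi s =
      Set.univ.pi fun i => if i = k then {_y | x ∈ s k} else s i := by
    ext e
    simp only [Set.mem_preimage, Set.mem_univ_pi]
    refine forall_congr' fun i => ?_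
    by_cases h : i = k
    · subst h; simp
    · simp [h]
  rw [this, Measure.pi_pi]
  refine Finset.prod_congr rfl fun i _ => ?_
  by_cases h : i = k
  · subst h
    by_cases hx : x ∈ s i <;> simp [hx, Measure.dirac_apply' _ (hs i)]
  · simp [h]

/-- Redrawing one coordinate of an i.i.d. family independently does not change its law. Together
with `pi_update_dirac` this amounts to conditioning on that coordinate. -/
lemma map_prod_pi_update (k : ι) :
    (μ.prod (Measure.pi fun _ : ι => μ)).map (fun p => Function.update p.2 k p.1) =
      Measure.pi fun _ : ι => μ := by
  refine (Measure.pi_eq fun s hs => ?_).symm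
  rw [Measure.map_apply (measurable_update_prod k) (MeasurableSet.univ_pi hs)]
  have : (fun p : β × (ι → β) => Function.update p.2 k p.1) ⁻¹' Set.univ.pi s =
      s k ×ˢ Set.univ.pi fun i => if i = k then Set.univ else s i := by
    ext p
    simp only [Set.mem_preimage, Set.mem_univ_pi, Set.mem_prod]
    constructor
    · intro h
      refine ⟨by simpa using h k, fun i => ?_⟩
      by_cases hi : i = k
      · simp [hi]
      · simpa [hi] using h i
    · rintro ⟨h1, h2⟩ i
      by_cases hi : i = k
      · subst hi; simpa using h1
      · simpa [hi] using h2 i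
  rw [this, Measure.prod_prod, Measure.pi_pi, ← Finset.mul_prod_erase _ _ (Finset.mem_univ k),
    ← Finset.mul_prod_erase (a := k) (f := fun i => μ (s i)) _ (Finset.mem_univ k)]
  simp only [if_true, measure_univ, one_mul]
  congr 1
  refine Finset.prod_congr rfl fun i hi => ?_
  simp [Finset.ne_of_mem_erase hi]

/-- Independent draws, conditioning on the draw with label `k`. -/
lemma lintegral_pi_eq_condition (k : ι) {φ : (ι → β) → β → ℝ≥0∞}
    (hφ : Measurable (Function.uncurry φ)) :
    ∫⁻ e, φ e (e k) ∂(Measure.pi fun _ : ι => μ) =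
      ∫⁻ x, ∫⁻ e, φ e x ∂(Measure.pi fun i => if i = k then Measure.dirac x else μ) ∂μ := by
  have hm : Measurable fun e : ι → β => φ e (e k) :=
    hφ.comp (by fun_prop : Measurable fun e : ι → β => (e, e k))
  conv_lhs => rw [← map_prod_pi_update μ k]
  rw [lintegral_map hm (measurable_update_prod k), lintegral_prod
    (fun p => φ (Function.update p.2 k p.1) (Function.update p.2 k p.1 k))
    (hm.comp (measurable_update_prod k)).aemeasurable]
  refine lintegral_congr fun x => ?_
  have hu : Measurable fun e : ι → β => Function.update e k x :=
    (measurable_update_prod k).comp (by fun_prop : Measurable fun e : ι → β => (x, e))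
  rw [← pi_update_dirac, lintegral_map (f := fun e => φ e x) (by fun_prop) hu]
  simp

lemma map_pi_comp_perm {ι : Type*} [Fintype ι] (μ : ι → Measure β) [∀ i, IsProbabilityMeasure (μ i)]
    (σ : Equiv.Perm ι) :
    (Measure.pi μ).map (fun e => e ∘ σ) = Measure.pi fun i => μ (σ i) := by
  refine (Measure.pi_eq fun s hs => ?_).symm
  rw [Measure.map_apply (by fun_prop) (MeasurableSet.univ_pi hs)]
  have : (fun e : ι → β => e ∘ σ) ⁻¹' Set.univ.pi s = Set.univ.pi fun i => s (σ.symm i) := by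
    ext e
    simp only [Set.mem_preimage, Set.mem_univ_pi, Function.comp]
    exact ⟨fun h i => by simpa using h (σ.symm i), fun h i => by simpa using h (σ i)⟩
  rw [this, Measure.pi_pi, ← Equiv.prod_comp σ]
  simp

end Pi

/-! ### Reversibility and time reversal. -/

lemma lintegral_isReversible {κ : Kernel β β} [IsMarkovKernel κ] {μ : Measure β}
    [IsFiniteMeasure μ] (h : κ.IsReversible μ) {F : β → β → ℝ≥0∞}
    (hF : Measurable (Function.uncurry F)) :
    ∫⁻ x, ∫⁻ y, F x y ∂(κ x) ∂μ = ∫⁻ x, ∫⁻ y, F y x ∂(κ x) ∂μ := by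
  have : (μ ⊗ₘ κ).map Prod.swap = μ ⊗ₘ κ := by
    -- Reversibility is symmetry of the joint law on rectangles, and these determine a finite
    -- measure on the product.
    refine Measure.ext_prod fun {s t} hs ht => ?_
    rw [Measure.map_apply measurable_swap (hs.prod ht), Set.preimage_swap_prod,
      Measure.compProd_apply_prod hs ht, Measure.compProd_apply_prod ht hs]
    exact h ht hs
  calc ∫⁻ x, ∫⁻ y, F x y ∂(κ x) ∂μ = ∫⁻ p, Function.uncurry F p ∂(μ ⊗ₘ κ) :=
        (Measure.lintegral_compProd hF).symm
    _ = ∫⁻ p, Function.uncurry F p.swap ∂(μ ⊗ₘ κ) := by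
        conv_lhs => rw [← this]
        rw [lintegral_map hF measurable_swap]
    _ = _ := Measure.lintegral_compProd (hF.comp measurable_swap)

end Generic

/-- Time reversal of an annealed Markov chain, with incremental weights `w t = g (t + 1) / g t` and
kernels `K t` reversible with respect to the density `g t`. -/
lemma lintegral_reverse {Z : Type*} [MeasurableSpace Z] (ν : Measure Z) (g w : ℕ → Z → ℝ≥0∞)
    (hw : ∀ t, Measurable (w t)) (K : ℕ → Kernel Z Z)
    [∀ t, IsMarkovKernel (K t)] (n : ℕ) (hgw : ∀ t ≤ n, ∀ x, g t x * w t x = g (t + 1) x)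
    (hrev : ∀ t ≤ n + 1, ∀ F : Z → Z → ℝ≥0∞, Measurable (Function.uncurry F) →
      ∫⁻ x, g t x * ∫⁻ y, F x y ∂(K t x) ∂ν = ∫⁻ x, g t x * ∫⁻ y, F y x ∂(K t x) ∂ν)
    {G : Z × (Fin (n + 1) → Z) × Z → ℝ≥0∞} (hG : Measurable G) :
    ∫⁻ z, g 0 z * ∫⁻ u, (∏ t : Fin (n + 1), w t (u t)) *
        ∫⁻ v, G (z, u, v) ∂(K (n + 1) (u (Fin.last n)))
      ∂(pathLaw (K 0) (fun s => (K (s + 1)).comap Prod.snd measurable_snd) n z) ∂ν =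
    ∫⁻ v, g (n + 1) v * ∫⁻ e, ∫⁻ z, G (z, fun t => e (Fin.rev t), v) ∂(K 0 (e (Fin.last n)))
      ∂(pathLaw (K (n + 1)) (fun s => (K (n - s)).comap Prod.snd measurable_snd) n v) ∂ν := by
  induction n with
  | zero =>
    have h1 : ∀ z, ∫⁻ u, (∏ t : Fin (0 + 1), w t (u t)) *
        ∫⁻ v, G (z, u, v) ∂(K (0 + 1) (u (Fin.last 0)))
      ∂(pathLaw (K 0) (fun s => (K (s + 1)).comap Prod.snd measurable_snd) 0 z) =
        ∫⁻ x, w 0 x * ∫⁻ v, G (z, fun _ => x, v) ∂(K 1 x) ∂(K 0 z) := fun z => by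
      rw [lintegral_pathLaw_zero _ _ _ (by fun_prop)]
      simp
    have h2 : ∀ v, ∫⁻ e, ∫⁻ z, G (z, fun t => e (Fin.rev t), v) ∂(K 0 (e (Fin.last 0)))
      ∂(pathLaw (K (0 + 1)) (fun s => (K (0 - s)).comap Prod.snd measurable_snd) 0 v) =
        ∫⁻ x, ∫⁻ z, G (z, fun _ => x, v) ∂(K 0 x) ∂(K 1 v) := fun v => by
      rw [lintegral_pathLaw_zero _ _ _ (by fun_prop)]
    simp only [h1, h2]
    -- Reversibility at time 0 exchanges `z` with the path point, reversibility at time 1 exchanges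
    -- that point with `v`; between them the weight turns `g 0` into `g 1`.
    rw [hrev 0 (by omega) (fun z x => w 0 x * ∫⁻ v, G (z, fun _ => x, v) ∂(K 1 x)) (by fun_prop)]
    rw [← hrev 1 (by omega) (fun x v => ∫⁻ z, G (z, fun _ => x, v) ∂(K 0 x)) (by fun_prop)]
    refine lintegral_congr fun x => ?_
    rw [lintegral_const_mul _ (by fun_prop), ← mul_assoc, hgw 0 le_rfl,
      lintegral_lintegral_swap (Measurable.aemeasurable (by fun_prop))]
  | succ n ih =>
    have h1 : ∀ z, ∫⁻ u, (∏ t : Fin (n + 1 + 1), w t (u t)) *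
        ∫⁻ v, G (z, u, v) ∂(K (n + 1 + 1) (u (Fin.last (n + 1))))
      ∂(pathLaw (K 0) (fun s => (K (s + 1)).comap Prod.snd measurable_snd) (n + 1) z) =
        ∫⁻ u, (∏ t : Fin (n + 1), w t (u t)) * ∫⁻ x, w (n + 1) x *
          ∫⁻ v, G (z, Fin.snoc (α := fun _ => Z) u x, v) ∂(K (n + 2) x)
            ∂(K (n + 1) (u (Fin.last n)))
        ∂(pathLaw (K 0) (fun s => (K (s + 1)).comap Prod.snd measurable_snd) n z) := fun z => by
      rw [lintegral_pathLaw_succ _ _ _ _ (by fun_prop)]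
      refine lintegral_congr fun u => ?_
      rw [← lintegral_const_mul _ (by fun_prop), Kernel.comap_apply]
      refine lintegral_congr fun x => ?_
      rw [Fin.prod_univ_castSucc]
      simp [mul_assoc]
    have h2 : ∀ v, ∫⁻ e, ∫⁻ z, G (z, fun t => e (Fin.rev t), v) ∂(K 0 (e (Fin.last (n + 1))))
      ∂(pathLaw (K (n + 1 + 1)) (fun s => (K (n + 1 - s)).comap Prod.snd measurable_snd)
        (n + 1) v) =
        ∫⁻ x, ∫⁻ e, ∫⁻ z, G (z, Fin.snoc (α := fun _ => Z) (fun t => e (Fin.rev t)) x, v)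
          ∂(K 0 (e (Fin.last n)))
        ∂(pathLaw (K (n + 1)) (fun s => (K (n - s)).comap Prod.snd measurable_snd) n x)
        ∂(K (n + 2) v) := fun v => by
      -- The last point of the forward path is the first one visited by the reversed chain, so the
      -- latter is split at its start.
      rw [lintegral_pathLaw_cons _ _ _ _ (by fun_prop)]
      refine lintegral_congr fun x => ?_
      rw [pathLaw_congr ((K (n + 1 - 0)).comap Prod.snd measurable_snd)
        (fun s => ((K (n + 1 - (s + 1))).comap Prod.snd measurable_snd).comap
          (fun p : (Z × Z) × Z => (p.1.1, p.2)) (by fun_prop)) (K₀' := K (n + 1))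
        (K' := fun s => (K (n - s)).comap Prod.snd measurable_snd) (a' := x)]
      · refine lintegral_congr fun e => ?_
        rw [← Fin.succ_last, Fin.cons_succ]
        refine lintegral_congr fun z => congrArg (fun u => G (z, u, v)) ?_
        ext t
        exact Fin.cons_rev x e t
      · rfl
      · intro s _ y
        simp [Kernel.comap_apply]
    simp only [h1, h2]
    -- The last path point plays the role of the endpoint of the shorter chain; its weight and the
    -- final transition are absorbed into the test function.
    rw [ih (fun t ht => hgw t (by omega)) (fun t ht => hrev t (by omega))
      (G := fun p => w (n + 1) p.2.2 * ∫⁻ v, G (p.1, Fin.snoc (α := fun _ => Z) p.2.1 p.2.2, v)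
        ∂(K (n + 2) p.2.2)) (by fun_prop)]
    rw [← hrev (n + 2) le_rfl (fun x v => ∫⁻ e, ∫⁻ z,
      G (z, Fin.snoc (α := fun _ => Z) (fun t => e (Fin.rev t)) x, v) ∂(K 0 (e (Fin.last n)))
        ∂(pathLaw (K (n + 1)) (fun s => (K (n - s)).comap Prod.snd measurable_snd) n x))
      (by fun_prop)]
    refine lintegral_congr fun x => ?_
    rw [← hgw (n + 1) le_rfl, mul_assoc,
      lintegral_lintegral_swap (Measurable.aemeasurable (by fun_prop)),
      ← lintegral_const_mul (w (n + 1) x) (by fun_prop)]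
    congr 1
    refine lintegral_congr fun e => ?_
    dsimp only
    rw [lintegral_const_mul _ (by fun_prop),
      lintegral_lintegral_swap (Measurable.aemeasurable (by fun_prop))]

/-! ### Sequences indexed by `ℕ`, and cancellation of the selection denominator. -/

/-- Extension of a finite sequence to `ℕ`. -/
def extend {X : Type*} {n : ℕ} (u : Fin (n + 1) → X) (s : ℕ) : X := u (Fin.ofNat (n + 1) s)

section Extend

variable {X : Type*} {n : ℕ}

@[fun_prop]
lemma measurable_extend [MeasurableSpace X] : Measurable (extend : (Fin (n + 1) → X) → ℕ → X) :=
  measurable_pi_iff.mpr fun _ => measurable_pi_apply _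

lemma extend_val (u : Fin (n + 1) → X) (t : Fin (n + 1)) : extend u t = u t := by
  simp [extend]

lemma extend_snoc_last (u : Fin (n + 1) → X) (x : X) :
    extend (Fin.snoc (α := fun _ => X) u x) (n + 1) = x := by
  have h := extend_val (Fin.snoc (α := fun _ => X) u x) (Fin.last (n + 1))
  rwa [Fin.snoc_last] at h

/-- The bound matters: past its last index `extend` wraps around. -/
lemma extend_snoc_of_le (u : Fin (n + 1) → X) (x : X) {s : ℕ} (hs : s ≤ n) :
    extend (Fin.snoc (α := fun _ => X) u x) s = extend u s := by
  have h := extend_val (Fin.snoc (α := fun _ => X) u x) (Fin.castSucc ⟨s, by omega⟩)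
  rw [Fin.snoc_castSucc] at h
  exact h.trans (extend_val u ⟨s, by omega⟩).symm

end Extend

/-- When the total weight vanishes so does each weight, and the uniform convention in `normWeight`
has no effect. -/
lemma sum_mul_normWeight {N : ℕ} (w : Fin N → ℝ≥0) (j : Fin N) :
    (∑ i, (w i : ℝ≥0∞)) * normWeight w j = w j := by
  rw [← ENNReal.ofNNReal_finsetSum]
  by_cases h : ∑ i, w i = 0
  · have : w j = 0 := (Finset.sum_eq_zero_iff.mp h) j (Finset.mem_univ j)
    simp [h, this]
  · rw [normWeight, if_neg h, ← ENNReal.coe_mul, mul_div_cancel₀ _ h]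

/-! ### The particle system as a mixture over retained paths. -/

namespace AnnealedModel

variable {Θ Z : Type*} [MeasurableSpace Θ] [MeasurableSpace Z] {m : Measure Θ} {ν : Measure Z}
  {T : ℕ} (M : AnnealedModel m ν T) (N : ℕ) [NeZero N]

@[fun_prop]
lemma measurable_weight_comp {α : Type*} [MeasurableSpace α] (t : ℕ) {g h : α → Θ} {u : α → Z}
    (hg : Measurable g) (hh : Measurable h) (hu : Measurable u) :
    Measurable fun a => M.weight t (g a) (h a) (u a) :=
  (M.measurable_weight t).comp (hg.prodMk (hh.prodMk hu))

/-- The first `n + 1` generations of the SMC sampler. -/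
noncomputable def smcUpTo (n : ℕ) : Kernel (Θ × Θ × Z) (Fin (n + 1) → Fin N → Z) :=
  pathLaw (independent fun _ : Fin N => M.initMove)
    (fun s => independent fun _ : Fin N => M.move N s) n

/-- The initial generation given that its particle with label `k` is `x`. -/
noncomputable def condInit (k : Fin N) : Kernel ((Θ × Θ × Z) × Z) (Fin N → Z) :=
  independent fun i : Fin N =>
    if i = k then Kernel.deterministic (fun a : (Θ × Θ × Z) × Z => a.2) (by fun_prop)
    else M.initMove.comap Prod.fst measurable_fst

/-- The generation `s + 1` given the generation `s` and given that its particle with label `k`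
is `x`. -/
noncomputable def condMove (s : ℕ) (k : Fin N) :
    Kernel (((Θ × Θ × Z) × (Fin N → Z)) × Z) (Fin N → Z) :=
  independent fun i : Fin N =>
    if i = k then
      Kernel.deterministic (fun p : ((Θ × Θ × Z) × (Fin N → Z)) × Z => p.2) (by fun_prop)
    else (M.move N s).comap Prod.fst measurable_fst

instance (k : Fin N) : IsMarkovKernel (M.condInit N k) := by unfold condInit; infer_instance

instance (s : ℕ) (k : Fin N) : IsMarkovKernel (M.condMove N s k) := by
  unfold condMove; infer_instance

lemma condInit_apply {N : ℕ} (k : Fin N) (a : Θ × Θ × Z) (x : Z) :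
    M.condInit N k (a, x) =
      Measure.pi fun i => if i = k then Measure.dirac x else M.initMove a := by
  rw [condInit, independent_apply]
  congr 1
  ext1 i
  split_ifs <;> rfl

lemma condMove_apply (s : ℕ) (k : Fin N) (p : (Θ × Θ × Z) × (Fin N → Z)) (x : Z) :
    M.condMove N s k (p, x) =
      Measure.pi fun i => if i = k then Measure.dirac x else M.move N s p := by
  rw [condMove, independent_apply]
  congr 1
  ext1 i
  split_ifs <;> rfl

/-- The first `n + 1` generations of the conditional SMC sampler. -/
noncomputable def csmcUpTo (b : ℕ → Fin N) (n : ℕ) :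
    Kernel ((Θ × Θ × Z) × (ℕ → Z)) (Fin (n + 1) → Fin N → Z) :=
  pathLaw ((M.condInit N (b 0)).comap (fun a => (a.1, a.2 0)) (by fun_prop))
    (fun s => (M.condMove N s (b (s + 1))).comap
      (fun p : ((Θ × Θ × Z) × (ℕ → Z)) × (Fin N → Z) => ((p.1.1, p.2), p.1.2 (s + 1)))
      (by fun_prop)) n

instance (n : ℕ) : IsMarkovKernel (M.smcUpTo N n) := by unfold smcUpTo; infer_instance

instance (b : ℕ → Fin N) (n : ℕ) : IsMarkovKernel (M.csmcUpTo N b n) := by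
  unfold csmcUpTo; infer_instance

/-- The Markov chain with transitions `R_{θ, θ', s + 1}` started from `R_θ(z, ·)`. -/
noncomputable def forwardPath (n : ℕ) : Kernel (Θ × Θ × Z) (Fin (n + 1) → Z) :=
  pathLaw M.initMove
    (fun s => (M.R (s + 1)).comap
      (fun p : (Θ × Θ × Z) × Z => (p.1.1, p.1.2.1, p.2)) (by fun_prop)) n

instance (n : ℕ) : IsMarkovKernel (M.forwardPath n) := by unfold forwardPath; infer_instance

/-- Generations up to `n` only see labels and path points up to `n`; the appended label and point
enter solely in the last generation. -/
lemma lintegral_csmcUpTo_snoc (n : ℕ) (b : Fin (n + 1) → Fin N) (k : Fin N) (a : Θ × Θ × Z)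
    (u : Fin (n + 1) → Z) (x : Z) {F : (Fin (n + 2) → Fin N → Z) → ℝ≥0∞} (hF : Measurable F) :
    ∫⁻ ζ, F ζ ∂(M.csmcUpTo N (extend (Fin.snoc (α := fun _ => Fin N) b k)) (n + 1)
        (a, extend (Fin.snoc (α := fun _ => Z) u x))) =
      ∫⁻ ζ, ∫⁻ e, F (Fin.snoc (α := fun _ => Fin N → Z) ζ e)
        ∂(M.condMove N n k ((a, ζ (Fin.last n)), x)) ∂(M.csmcUpTo N (extend b) n (a, extend u)) := by
  rw [csmcUpTo, lintegral_pathLaw_succ _ _ _ _ hF, csmcUpTo]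
  simp only [Kernel.comap_apply, extend_snoc_last]
  congr 1
  refine pathLaw_congr _ _ _ _ _ _ ?_ _ fun s hs e => ?_
  · simp [Kernel.comap_apply, extend_snoc_of_le]
  · simp [Kernel.comap_apply, extend_snoc_of_le _ _ (Nat.succ_le_of_lt hs)]

/-- One step of unrolling: conditioning on the particle `k` of the new generation exposes its
selection of an ancestor `j`, whose denominator the total weight cancels. The other particles keep
their normalised resampling. -/
lemma sum_weight_mul_lintegral_move (s : ℕ) (a : Θ × Θ × Z) (e : Fin N → Z) (k : Fin N)
    {φ : (Fin N → Z) → Z → ℝ≥0∞} (hφ : Measurable (Function.uncurry φ)) :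
    (∑ j, (M.weight s a.1 a.2.1 (e j) : ℝ≥0∞)) *
        ∫⁻ e', φ e' (e' k) ∂(independent (fun _ : Fin N => M.move N s) (a, e)) =
      ∑ j, (M.weight s a.1 a.2.1 (e j) : ℝ≥0∞) *
        ∫⁻ x, ∫⁻ e', φ e' x ∂(M.condMove N s k ((a, e), x)) ∂(M.R (s + 1) (a.1, a.2.1, e j)) := by
  rw [independent_apply, lintegral_pi_eq_condition _ k hφ]
  simp only [← condMove_apply]
  conv_lhs => rw [move, lintegral_mixture]
  rw [Finset.mul_sum]
  refine Finset.sum_congr rfl fun j _ => ?_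
  rw [← mul_assoc, sum_mul_normWeight]
  rfl

/-- The unnormalised law of the particles is a mixture, over the labels of a retained path, of
the annealed path law followed by conditional SMC. -/
theorem lintegral_smcUpTo (n : ℕ) (a : Θ × Θ × Z) (S : Kernel Z Z) [IsMarkovKernel S]
    {ψ : (Fin (n + 1) → Fin N → Z) × Z → ℝ≥0∞} (hψ : Measurable ψ) :
    ∫⁻ ζ, (∏ t : Fin n, (N : ℝ≥0∞)⁻¹ * ∑ i, (M.weight t a.1 a.2.1 (ζ t.castSucc i) : ℝ≥0∞)) *
        ((N : ℝ≥0∞)⁻¹ * ∑ j, (M.weight n a.1 a.2.1 (ζ (Fin.last n) j) : ℝ≥0∞) *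
          ∫⁻ v, ψ (ζ, v) ∂(S (ζ (Fin.last n) j))) ∂(M.smcUpTo N n a) =
      (N : ℝ≥0∞)⁻¹ ^ (n + 1) * ∑ b : Fin (n + 1) → Fin N,
        ∫⁻ u, (∏ t : Fin (n + 1), (M.weight t a.1 a.2.1 (u t) : ℝ≥0∞)) *
          ∫⁻ v, ∫⁻ ζ, ψ (ζ, v) ∂(M.csmcUpTo N (extend b) n (a, extend u)) ∂(S (u (Fin.last n)))
          ∂(M.forwardPath n a) := by
  induction n generalizing S with
  | zero =>
    rw [smcUpTo, lintegral_pathLaw_zero _ _ _ (by fun_prop)]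
    simp only [Finset.univ_eq_empty, Finset.prod_empty, one_mul, zero_add, pow_one]
    rw [lintegral_const_mul _ (by fun_prop), lintegral_finsetSum _ (by fun_prop)]
    congr 1
    -- A labelling of a single generation is just the index `j` of the selected particle.
    refine Fintype.sum_equiv (Equiv.funUnique (Fin 1) (Fin N)).symm _ _ fun j => ?_
    rw [forwardPath, lintegral_pathLaw_zero _ _ _ (by fun_prop), independent_apply,
      lintegral_pi_eq_condition (M.initMove a) j
        (φ := fun e x => (M.weight 0 a.1 a.2.1 x : ℝ≥0∞) * ∫⁻ v, ψ (fun _ => e, v) ∂(S x))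
        (by fun_prop)]
    refine lintegral_congr fun x => ?_
    rw [← M.condInit_apply j a x, lintegral_const_mul _ (by fun_prop),
      lintegral_lintegral_swap (Measurable.aemeasurable (by fun_prop))]
    congr 1
    · simp
    refine lintegral_congr fun v => ?_
    rw [csmcUpTo, lintegral_pathLaw_zero _ _ _ (by fun_prop)]
    rfl
  | succ n ih =>
    -- The last generation integrated out, given that its particle `k` sits at `p.2`. The hypothesis
    -- is used with `R (n + 1)` in place of `S`, so that the endpoint of the shorter sampler is the
    -- retained particle of generation `n + 1`. This is why `S` is generalised.
    set ψ' : Fin N → (Fin (n + 1) → Fin N → Z) × Z → ℝ≥0∞ := fun k p =>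
      ∫⁻ e, (M.weight (n + 1) a.1 a.2.1 p.2 : ℝ≥0∞) *
        ∫⁻ v, ψ (Fin.snoc (α := fun _ => Fin N → Z) p.1 e, v) ∂(S p.2)
        ∂(M.condMove N n k ((a, p.1 (Fin.last n)), p.2)) with hψ'
    have hψ'm : ∀ k, Measurable (ψ' k) := fun k => by fun_prop
    have key : ∀ k, _ := fun k => ih ((M.R (n + 1)).comap (fun z => (a.1, a.2.1, z)) (by fun_prop))
      (hψ'm k)
    calc _ = ∫⁻ ζ, ∑ k, (N : ℝ≥0∞)⁻¹ * ((∏ t : Fin n, (N : ℝ≥0∞)⁻¹ *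
              ∑ i, (M.weight t a.1 a.2.1 (ζ t.castSucc i) : ℝ≥0∞)) *
            ((N : ℝ≥0∞)⁻¹ * ∑ j, (M.weight n a.1 a.2.1 (ζ (Fin.last n) j) : ℝ≥0∞) *
              ∫⁻ v, ψ' k (ζ, v) ∂((M.R (n + 1)).comap (fun z => (a.1, a.2.1, z)) (by fun_prop)
                (ζ (Fin.last n) j)))) ∂(M.smcUpTo N n a) := by
          rw [smcUpTo, lintegral_pathLaw_succ _ _ _ _ (by fun_prop), smcUpTo]
          refine lintegral_congr fun ζ => ?_
          simp only [Fin.prod_univ_castSucc, Fin.snoc_castSucc, Fin.snoc_last, Fin.val_castSucc,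
            Fin.val_last, Kernel.comap_apply]
          rw [lintegral_const_mul _ (by fun_prop), lintegral_const_mul _ (by fun_prop),
            lintegral_finsetSum _ (by fun_prop)]
          have h : ∀ k, _ := fun k => M.sum_weight_mul_lintegral_move N n a (ζ (Fin.last n)) k
            (φ := fun e x => (M.weight (n + 1) a.1 a.2.1 x : ℝ≥0∞) *
              ∫⁻ v, ψ (Fin.snoc (α := fun _ => Fin N → Z) ζ e, v) ∂(S x)) (by fun_prop)
          simp only [hψ', ← h, ← Finset.mul_sum]
          ring
      _ = ∑ k, (N : ℝ≥0∞)⁻¹ * _ := by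
          rw [lintegral_finsetSum _ (by fun_prop)]
          refine Finset.sum_congr rfl fun k _ => ?_
          rw [lintegral_const_mul _ (by fun_prop), key k]
      _ = _ := by
          -- A labelling of `n + 2` generations is one of `n + 1` generations together with the
          -- label `k` of the last.
          rw [← Fintype.sum_equiv (Fin.snocEquiv fun _ => Fin N) (fun p => _) _ fun p => rfl,
            Fintype.sum_prod_type, Finset.mul_sum]
          refine Finset.sum_congr rfl fun k _ => ?_
          rw [← mul_assoc, ← pow_succ']
          congr 1
          refine Finset.sum_congr rfl fun b _ => ?_
          simp only [Fin.snocEquiv, Equiv.coe_fn_mk]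
          conv_rhs => rw [forwardPath, lintegral_pathLaw_succ _ _ _ _ (by fun_prop)]
          rw [forwardPath]
          refine lintegral_congr fun u => ?_
          rw [← lintegral_const_mul _ (by fun_prop)]
          refine lintegral_congr fun x => ?_
          simp only [Fin.prod_univ_castSucc (n := n + 1), Fin.snoc_castSucc, Fin.snoc_last,
            Fin.val_castSucc, Fin.val_last, mul_assoc]
          congr 1
          have h : ∀ v, _ := fun v =>
            M.lintegral_csmcUpTo_snoc N n b k a u x (F := fun ζ => ψ (ζ, v)) (by fun_prop)
          simp only [h]
          rw [hψ', lintegral_lintegral_swap (Measurable.aemeasurable (by fun_prop)),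
            ← lintegral_const_mul _ (by fun_prop)]
          refine lintegral_congr fun ζ => ?_
          dsimp only
          rw [lintegral_const_mul _ (by fun_prop),
            lintegral_lintegral_swap (Measurable.aemeasurable (by fun_prop))]

end AnnealedModel

/-! ### Relabelling, unnormalised reversibility and the model's retained path. -/

lemma normWeight_comp_perm {N : ℕ} (w : Fin N → ℝ≥0) (σ : Equiv.Perm (Fin N)) (j : Fin N) :
    normWeight (fun i => w (σ i)) j = normWeight w (σ j) := by
  simp only [normWeight, Equiv.sum_comp σ w]

/-- The normalising constant is a common factor, cancelled because it is neither `0` nor `∞`. -/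
lemma lintegral_isReversible_normalisedLaw {Z : Type*} [MeasurableSpace Z] {ν : Measure Z}
    {f : Z → ℝ≥0} (hf : Measurable f) (h0 : ∫⁻ z, f z ∂ν ≠ 0) (h1 : ∫⁻ z, f z ∂ν ≠ ∞)
    {κ : Kernel Z Z} [IsMarkovKernel κ] (h : κ.IsReversible (normalisedLaw ν f))
    {F : Z → Z → ℝ≥0∞} (hF : Measurable (Function.uncurry F)) :
    ∫⁻ x, f x * ∫⁻ y, F x y ∂(κ x) ∂ν = ∫⁻ x, f x * ∫⁻ y, F y x ∂(κ x) ∂ν := by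
  have : IsFiniteMeasure (normalisedLaw ν f) := ⟨by
    simp [normalisedLaw, ENNReal.inv_mul_cancel h0 h1]⟩
  have := lintegral_isReversible h hF
  rw [normalisedLaw, lintegral_smul_measure, lintegral_smul_measure,
    lintegral_withDensity_eq_lintegral_mul _ (by fun_prop) (by fun_prop),
    lintegral_withDensity_eq_lintegral_mul _ (by fun_prop) (by fun_prop)] at this
  exact (ENNReal.mul_right_inj (ENNReal.inv_ne_zero.mpr h1) (ENNReal.inv_ne_top.mpr h0)).mp this

namespace AnnealedModel

variable {Θ Z : Type*} [MeasurableSpace Θ] [MeasurableSpace Z] {m : Measure Θ} {ν : Measure Z}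
  {T : ℕ} (M : AnnealedModel m ν T) (N : ℕ) [NeZero N]

section Measurability

variable {α : Type*} [MeasurableSpace α] {g h : α → Θ}

@[fun_prop]
lemma measurable_dens_comp {u : α → Z} (hg : Measurable g) (hu : Measurable u) :
    Measurable fun a => M.dens (g a) (u a) := M.measurable_dens.comp (hg.prodMk hu)

@[fun_prop]
lemma measurable_qDens_comp (hg : Measurable g) (hh : Measurable h) :
    Measurable fun a => M.qDens (g a) (h a) := M.measurable_qDens.comp (hg.prodMk hh)

@[fun_prop]
lemma measurable_f_comp (t : ℕ) {u : α → Z} (hg : Measurable g) (hh : Measurable h)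
    (hu : Measurable u) : Measurable fun a => M.f t (g a) (h a) (u a) :=
  (M.measurable_f t).comp (hg.prodMk (hh.prodMk hu))

@[fun_prop]
lemma measurable_estimate_comp {N : ℕ} {ζ : α → Fin (T + 1) → Fin N → Z} (hg : Measurable g)
    (hh : Measurable h) (hζ : Measurable ζ) :
    Measurable fun a => M.estimate (g a) (h a) (ζ a) := by
  unfold estimate; fun_prop

@[fun_prop]
lemma measurable_ratio_comp {N : ℕ} {ζ : α → Fin (T + 1) → Fin N → Z} (hg : Measurable g)
    (hh : Measurable h) (hζ : Measurable ζ) :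
    Measurable fun a => M.ratio (g a) (h a) (ζ a) := M.measurable_ratio hg hh hζ

end Measurability

/-! ### Conditional SMC and relabelling of the particles -/

lemma csmc_apply (b : Fin (T + 1) → Fin N) (p : (Θ × Θ × Z) × (Fin (T + 1) → Z)) :
    M.csmc N b p = M.csmcUpTo N (extend b) T (p.1, extend p.2) := by
  refine pathLaw_congr _ _ _ _ _ _ ?_ _ fun s _ e => ?_
  · rw [Kernel.comap_apply, condInit_apply, independent_apply]
    congr 1
    ext1 i
    change (if i = b 0 then _ else _ : Kernel _ _) _ = if i = b 0 then _ else _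
    split_ifs <;> rfl
  · rw [Kernel.comap_apply, condMove_apply, independent_apply]
    congr 1
    ext1 i
    change (if i = extend b (s + 1) then _ else _ : Kernel _ _) _ = _
    split_ifs <;> rfl

/-- Resampling sees the previous generation only as an unordered weighted sample. -/
lemma move_comp_perm {N : ℕ} (s : ℕ) (a : Θ × Θ × Z) (e : Fin N → Z) (σ : Equiv.Perm (Fin N)) :
    M.move N s (a, e ∘ σ) = M.move N s (a, e) := by
  change ∑ j, normWeight (fun i => M.weight s a.1 a.2.1 (e (σ i))) j •
      M.R (s + 1) (a.1, a.2.1, e (σ j)) =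
    ∑ j, normWeight (fun i => M.weight s a.1 a.2.1 (e i)) j • M.R (s + 1) (a.1, a.2.1, e j)
  simp only [normWeight_comp_perm fun i => M.weight s a.1 a.2.1 (e i)]
  exact Equiv.sum_comp σ fun j => normWeight (fun i => M.weight s a.1 a.2.1 (e i)) j •
    M.R (s + 1) (a.1, a.2.1, e j)

lemma condMove_comp_perm (s : ℕ) (k : Fin N) (a : Θ × Θ × Z) (e : Fin N → Z)
    (σ : Equiv.Perm (Fin N)) (x : Z) :
    M.condMove N s k ((a, e ∘ σ), x) = M.condMove N s k ((a, e), x) := by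
  rw [condMove_apply, condMove_apply, move_comp_perm]

lemma map_pi_if_swap {N : ℕ} (k l : Fin N) (μ₁ μ₂ : Measure Z) [IsProbabilityMeasure μ₁]
    [IsProbabilityMeasure μ₂] :
    (Measure.pi fun i => if i = k then μ₁ else μ₂).map (fun e => e ∘ Equiv.swap k l) =
      Measure.pi fun i => if i = l then μ₁ else μ₂ := by
  have : ∀ i, IsProbabilityMeasure (if i = k then μ₁ else μ₂) := fun i => by
    split_ifs <;> infer_instance
  rw [map_pi_comp_perm]
  congr 1
  ext1 i
  simp only [Equiv.swap_apply_eq_iff, Equiv.swap_apply_left]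

/-- The labels of the retained path do not matter for symmetric functions of the particles. -/
lemma lintegral_csmc_of_symmetric (b b' : Fin (T + 1) → Fin N)
    (p : (Θ × Θ × Z) × (Fin (T + 1) → Z)) {F : (Fin (T + 1) → Fin N → Z) → ℝ≥0∞}
    (hF : Measurable F)
    (hsymm : ∀ (σ : Fin (T + 1) → Equiv.Perm (Fin N)) ζ, F (fun t => ζ t ∘ σ t) = F ζ) :
    ∫⁻ ζ, F ζ ∂(M.csmc N b p) = ∫⁻ ζ, F ζ ∂(M.csmc N b' p) := by
  rw [csmc_apply, csmc_apply, csmcUpTo, csmcUpTo]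
  -- At each time, swapping the two labels carries one conditional sampler to the other. Transitions
  -- are intertwined because they ignore the order of the preceding generation.
  refine (lintegral_congr fun ζ =>
      (hsymm (fun t => Equiv.swap (extend b t) (extend b' t)) ζ).symm).trans
    (lintegral_pathLaw_map _ _ _ _ (p.1, extend p.2) (p.1, extend p.2)
      (fun s e => e ∘ Equiv.swap (extend b s) (extend b' s)) (fun s => by fun_prop) ?_ T ?_ hF)
  · rw [Kernel.comap_apply, Kernel.comap_apply, condInit_apply, condInit_apply, map_pi_if_swap]
  · intro s _ e
    rw [Kernel.comap_apply, Kernel.comap_apply, condMove_comp_perm, condMove_apply,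
      condMove_apply, map_pi_if_swap]

/-! ### The retained path and its time reversal -/

/-- The kernels `R_θ, R_{θ, θ', 1}, …, R_{θ, θ', T}, R_{θ'}`. -/
noncomputable def annealedKernel (θ η : Θ) (t : ℕ) : Kernel Z Z :=
  if t = 0 then M.R₀.comap (fun z => (θ, z)) (by fun_prop)
  else if t = T + 1 then M.R₀.comap (fun z => (η, z)) (by fun_prop)
  else (M.R t).comap (fun z => (θ, η, z)) (by fun_prop)

instance (θ η : Θ) (t : ℕ) : IsMarkovKernel (M.annealedKernel θ η t) := by
  unfold annealedKernel; infer_instance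

lemma annealedKernel_zero (θ η : Θ) (z : Z) : M.annealedKernel θ η 0 z = M.R₀ (θ, z) := rfl

lemma annealedKernel_last (θ η : Θ) (z : Z) :
    M.annealedKernel θ η (T + 1) z = M.R₀ (η, z) := by
  simp [annealedKernel, Kernel.comap_apply]

lemma annealedKernel_of_mem (θ η : Θ) {t : ℕ} (h1 : t ≠ 0) (h2 : t ≤ T) (z : Z) :
    M.annealedKernel θ η t z = M.R t (θ, η, z) := by
  rw [annealedKernel, if_neg h1, if_neg (by omega), Kernel.comap_apply]

lemma isReversible_annealedKernel (θ η : Θ) {t : ℕ} (ht : t ≤ T + 1) :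
    (M.annealedKernel θ η t).IsReversible (normalisedLaw ν (M.f t θ η)) := by
  unfold annealedKernel
  split_ifs with h0 h1
  · have : M.f t θ η = M.dens θ := by subst h0; exact funext (M.f_zero θ η)
    exact this ▸ M.R₀_reversible θ
  · have : M.f t θ η = M.dens η := by subst h1; exact funext (M.f_last θ η)
    exact this ▸ M.R₀_reversible η
  · exact M.R_reversible t (by omega) (by omega) θ η

/-- The division defining the weight returns `0` where `f t` vanishes; equality of supports makes `f
(t + 1)` vanish there too. -/
lemma f_mul_weight {t : ℕ} (ht : t ≤ T) (θ η : Θ) (z : Z) :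
    (M.f t θ η z : ℝ≥0∞) * M.weight t θ η z = M.f (t + 1) θ η z := by
  rw [← ENNReal.coe_mul, weight]
  by_cases h : M.f t θ η z = 0
  · have h' : M.f (t + 1) θ η z = 0 := not_not.mp fun h' => (M.f_support t ht θ η z).mpr h' h
    simp [h, h']
  · rw [mul_div_cancel₀ _ h]

lemma lintegral_forwardPath_reverse [SFinite ν] (θ η : Θ)
    {G : Z × (Fin (T + 1) → Z) × Z → ℝ≥0∞} (hG : Measurable G) :
    ∫⁻ z, M.dens θ z * ∫⁻ u, (∏ t : Fin (T + 1), (M.weight t θ η (u t) : ℝ≥0∞)) *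
        ∫⁻ v, G (z, u, v) ∂(M.R₀ (η, u (Fin.last T))) ∂(M.forwardPath T (θ, η, z)) ∂ν =
      ∫⁻ v, M.dens η v * ∫⁻ u, ∫⁻ z, G (z, u, v) ∂(M.R₀ (θ, u 0))
        ∂(M.reversedPath (η, θ, v)) ∂ν := by
  have key := lintegral_reverse ν (fun t z => M.f t θ η z) (fun t z => M.weight t θ η z)
    (fun t => by fun_prop) (M.annealedKernel θ η) T
    (fun t ht z => M.f_mul_weight ht θ η z)
    (fun t ht F hF => lintegral_isReversible_normalisedLaw (by fun_prop) (M.f_mass_pos t ht θ η)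
      (M.f_mass_finite t ht θ η) (M.isReversible_annealedKernel θ η ht) hF) hG
  have hfwd : ∀ z, pathLaw (M.annealedKernel θ η 0) (fun s =>
      (M.annealedKernel θ η (s + 1)).comap Prod.snd measurable_snd) T z =
      M.forwardPath T (θ, η, z) := fun z => by
    rw [forwardPath]
    refine pathLaw_congr _ _ _ _ _ _ ?_ _ fun s hs x => ?_
    · rfl
    rw [Kernel.comap_apply, Kernel.comap_apply,
      annealedKernel_of_mem _ _ _ (by omega) (by omega)]
  have hrev : ∀ z, pathLaw (M.annealedKernel θ η (T + 1)) (fun s =>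
      (M.annealedKernel θ η (T - s)).comap Prod.snd measurable_snd) T z =
      pathLaw M.initMove (fun s => (M.R (T - s)).comap
        (fun p : (Θ × Θ × Z) × Z => (p.1.2.1, p.1.1, p.2)) (by fun_prop)) T (η, θ, z) := fun z => by
    refine pathLaw_congr _ _ _ _ _ _ ?_ _ fun s hs x => ?_
    · rw [annealedKernel_last]; rfl
    · rw [Kernel.comap_apply, Kernel.comap_apply,
        annealedKernel_of_mem _ _ _ (by omega) (by omega)]
  simp only [hfwd, hrev, annealedKernel_last, annealedKernel_zero, M.f_zero, M.f_last] at key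
  rw [key]
  refine lintegral_congr fun v => ?_
  rw [reversedPath, Kernel.lintegral_map _ (by fun_prop) _ (by fun_prop)]
  simp only [Fin.rev_zero]

/-! ### The two proposals, up to the density of the parameter proposal -/

/-- The SMC proposal reweighted by the normalising-constant estimate is a uniform mixture of the
conditional SMC proposals. -/
theorem lintegral_smc_estimate [SFinite ν] (θ η : Θ)
    {F : Z × (Fin (T + 1) → Fin N → Z) × Z → ℝ≥0∞} (hF : Measurable F) :
    ∫⁻ z, M.dens θ z * ∫⁻ ζ, M.estimate θ η ζ * ∫⁻ z', F (z, ζ, z')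
        ∂(M.finalMove N ((θ, η, z), ζ)) ∂(M.smc N (θ, η, z)) ∂ν =
      ((N : ℝ≥0∞) ^ (T + 1))⁻¹ * ∑ b : Fin (T + 1) → Fin N,
        ∫⁻ z', M.dens η z' * ∫⁻ u, ∫⁻ z, ∫⁻ ζ, F (z, ζ, z') ∂(M.csmc N b ((θ, η, z), u))
          ∂(M.R₀ (θ, u 0)) ∂(M.reversedPath (η, θ, z')) ∂ν := by
  -- The right side is reversed back to a forward path for each `b`, after which both sides can be
  -- compared at fixed `z`.
  simp only [← fun b => M.lintegral_forwardPath_reverse θ η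
    (G := fun p => ∫⁻ ζ, F (p.1, ζ, p.2.2) ∂(M.csmc N b ((θ, η, p.1), p.2.1))) (by fun_prop)]
  rw [← lintegral_finsetSum _ (by fun_prop), ← lintegral_const_mul _ (by fun_prop)]
  refine lintegral_congr fun z => ?_
  rw [← Finset.mul_sum, mul_left_comm, ENNReal.inv_pow]
  congr 1
  have key := M.lintegral_smcUpTo N T (θ, η, z) (M.R₀.comap (fun z => (η, z)) (by fun_prop))
    (ψ := fun p => F (z, p.1, p.2)) (by fun_prop)
  simp only [Kernel.comap_apply] at key
  simp only [csmc_apply]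
  rw [← key]
  refine lintegral_congr fun ζ => ?_
  -- The last factor of the estimate cancels the denominator of the final selection.
  rw [finalMove, lintegral_mixture, estimate, Fin.prod_univ_castSucc, mul_assoc, mul_assoc,
    Finset.mul_sum]
  congr 2
  refine Finset.sum_congr rfl fun j _ => ?_
  rw [← mul_assoc]
  simp only [Fin.val_last, sum_mul_normWeight, Kernel.comap_apply]

end AnnealedModel

/-! ### Metropolis acceptance and accept-reject kernels. -/

/-- With `r = b / a * C`, nondegenerate values give `b * C = a * r`, and `r * min 1 (1 / r) = min 1
r`. Here `a` and `b` are the forward and backward proposal densities. -/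
lemma metropolis_balance (a b : ℝ≥0) {C : ℝ≥0∞} (hC : C ≠ ∞) :
    (b : ℝ≥0∞) * (C * min 1 (1 / (b / a * C))) = a * min 1 (b / a * C) := by
  rcases eq_or_ne b 0 with rfl | hb
  · simp
  rcases eq_or_ne C 0 with rfl | hC0
  · simp
  -- Here the ratio is `∞`, so its reciprocal vanishes and both sides are `0`.
  rcases eq_or_ne a 0 with rfl | ha
  · rw [ENNReal.coe_zero, ENNReal.div_zero (by simpa using hb), ENNReal.top_mul hC0]
    simp
  have hr : (b : ℝ≥0∞) * C = a * (b / a * C) := by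
    rw [← mul_assoc, ENNReal.mul_div_cancel (by simpa using ha) ENNReal.coe_ne_top]
  rw [← mul_assoc, hr, mul_assoc]
  set r : ℝ≥0∞ := b / a * C
  have hr0 : r ≠ 0 := mul_ne_zero (ENNReal.div_ne_zero.mpr ⟨by simpa using hb, by simp⟩) hC0
  have hrt : r ≠ ∞ := ENNReal.mul_ne_top (ENNReal.div_ne_top (by simp) (by simpa using ha)) hC
  congr 1
  rcases le_total r 1 with h | h
  · rw [min_eq_right h, min_eq_left, mul_one]
    rw [one_div]
    exact ENNReal.one_le_inv.mpr h
  · rw [min_eq_left h, min_eq_right, one_div, ENNReal.mul_inv_cancel hr0 hrt]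
    rw [one_div]
    exact ENNReal.inv_le_one.mpr h

/-- The rejection term depends on `A ∩ B` only, hence is symmetric in the two sets; detailed balance
is thus a matter of accepted moves alone. -/
lemma setLIntegral_acceptReject {X U : Type*} [MeasurableSpace X] [MeasurableSpace U]
    (Q : Kernel X (X × U)) [IsMarkovKernel Q] (α : X × X × U → ℝ≥0∞) (hα : Measurable α)
    (π : Measure X) {A B : Set X} (hA : MeasurableSet A) (hB : MeasurableSet B) :
    ∫⁻ x in A, acceptReject Q α hα x B ∂π =
      ∫⁻ x, ∫⁻ p, A.indicator 1 x * B.indicator 1 p.1 * α (x, p) ∂(Q x) ∂π +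
        ∫⁻ x in A ∩ B, (1 - ∫⁻ p, α (x, p) ∂(Q x)) ∂π := by
  have hm : Measurable fun x => ∫⁻ p, α (x, p) ∂(Q x) := by fun_prop
  have hA1 : Measurable (A.indicator (1 : X → ℝ≥0∞)) := measurable_one.indicator hA
  have hB1 : Measurable (B.indicator (1 : X → ℝ≥0∞)) := measurable_one.indicator hB
  have h : ∀ x, acceptReject Q α hα x B = ∫⁻ p, B.indicator 1 p.1 * α (x, p) ∂(Q x) +
      B.indicator (fun x => 1 - ∫⁻ p, α (x, p) ∂(Q x)) x := fun x => by
    change (((Q x).withDensity fun p => α (x, p)).map Prod.fst +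
      (1 - ∫⁻ p, α (x, p) ∂(Q x)) • Measure.dirac x) B = _
    rw [Measure.add_apply, Measure.smul_apply, Measure.map_apply measurable_fst hB,
      withDensity_apply _ (measurable_fst hB), Measure.dirac_apply' _ hB, smul_eq_mul,
      ← lintegral_indicator (measurable_fst hB)]
    congr 1
    · refine lintegral_congr fun p => ?_
      by_cases hp : p.1 ∈ B <;> simp [Set.indicator, hp]
    · by_cases hx : x ∈ B <;> simp [hx]
  simp only [h]
  rw [lintegral_add_left (by fun_prop), lintegral_indicator hB, Measure.restrict_restrict hB,
    Set.inter_comm B A, ← lintegral_indicator hA]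
  congr 1
  refine lintegral_congr fun x => ?_
  simp only [mul_assoc]
  rw [lintegral_const_mul _ (by fun_prop)]
  by_cases hx : x ∈ A <;> simp [hx]

/-! ### Integrals against the target and the proposals; exchange of accepted moves. -/

namespace AnnealedModel

variable {Θ Z : Type*} [MeasurableSpace Θ] [MeasurableSpace Z] {m : Measure Θ} {ν : Measure Z}
  {T : ℕ} (M : AnnealedModel m ν T) (N : ℕ) [NeZero N]

lemma estimate_ne_top (θ η : Θ) (ζ : Fin (T + 1) → Fin N → Z) : M.estimate θ η ζ ≠ ∞ := by
  refine ENNReal.prod_ne_top fun t _ => ENNReal.mul_ne_top ?_ ?_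
  · simp [NeZero.ne N]
  · exact ENNReal.sum_ne_top.mpr fun i _ => ENNReal.coe_ne_top

lemma estimate_comp_perm {N : ℕ} (θ η : Θ) (σ : Fin (T + 1) → Equiv.Perm (Fin N))
    (ζ : Fin (T + 1) → Fin N → Z) :
    M.estimate θ η (fun t => ζ t ∘ σ t) = M.estimate θ η ζ := by
  refine Finset.prod_congr rfl fun t _ => ?_
  congr 1
  exact Equiv.sum_comp (σ t) fun i => (M.weight t θ η (ζ t i) : ℝ≥0∞)

lemma lintegral_target [SFinite ν] {F : Θ × Z → ℝ≥0∞} (hF : Measurable F) :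
    ∫⁻ x, F x ∂M.target = ∫⁻ θ, ∫⁻ z, M.dens θ z * F (θ, z) ∂ν ∂m := by
  rw [target, lintegral_withDensity_eq_lintegral_mul _ (by fun_prop) hF,
    lintegral_prod _ (Measurable.aemeasurable (by fun_prop))]
  rfl

lemma lintegral_q (θ : Θ) {F : Θ → ℝ≥0∞} (hF : Measurable F) :
    ∫⁻ η, F η ∂(M.q θ) = ∫⁻ η, M.qDens θ η * F η ∂m := by
  rw [M.q_eq, lintegral_withDensity_eq_lintegral_mul _ (by fun_prop) hF]
  rfl

lemma lintegral_Q₁ (x : Θ × Z) {F : (Θ × Z) × (Fin (T + 1) → Fin N → Z) → ℝ≥0∞}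
    (hF : Measurable F) :
    ∫⁻ p, F p ∂(M.Q₁ N x) = ∫⁻ η, M.qDens x.1 η * ∫⁻ ζ, ∫⁻ z', F ((η, z'), ζ)
      ∂(M.finalMove N ((x.1, η, x.2), ζ)) ∂(M.smc N (x.1, η, x.2)) ∂m := by
  rw [Q₁, Kernel.lintegral_map _ (by fun_prop) _ hF, Kernel.lintegral_compProd _ _ _ (by fun_prop),
    Kernel.lintegral_compProd _ _ _ (by fun_prop)]
  simp only [Kernel.comap_apply]
  rw [lintegral_q _ _ (by fun_prop)]

lemma lintegral_Q₂ (b : Fin (T + 1) → Fin N) (y : Θ × Z)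
    {F : (Θ × Z) × (Fin (T + 1) → Fin N → Z) → ℝ≥0∞} (hF : Measurable F) :
    ∫⁻ p, F p ∂(M.Q₂ N b y) = ∫⁻ θ, M.qDens y.1 θ * ∫⁻ u, ∫⁻ z, ∫⁻ ζ, F ((θ, z), ζ)
      ∂(M.csmc N b ((θ, y.1, z), u)) ∂(M.R₀ (θ, u 0)) ∂(M.reversedPath (y.1, θ, y.2)) ∂m := by
  rw [Q₂, Kernel.lintegral_map _ (by fun_prop) _ hF, Kernel.lintegral_compProd _ _ _ (by fun_prop),
    Kernel.lintegral_compProd _ _ _ (by fun_prop), Kernel.lintegral_compProd _ _ _ (by fun_prop)]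
  simp only [Kernel.comap_apply]
  rw [lintegral_q _ _ (by fun_prop)]

lemma lintegral_target_Q₁ [SFinite m] [SFinite ν]
    {F : (Θ × Z) × (Θ × Z) × (Fin (T + 1) → Fin N → Z) → ℝ≥0∞} (hF : Measurable F) :
    ∫⁻ x, ∫⁻ p, F (x, p) ∂(M.Q₁ N x) ∂M.target =
      ∫⁻ θ, ∫⁻ η, M.qDens θ η * ∫⁻ z, M.dens θ z * ∫⁻ ζ, ∫⁻ z', F ((θ, z), (η, z'), ζ)
        ∂(M.finalMove N ((θ, η, z), ζ)) ∂(M.smc N (θ, η, z)) ∂ν ∂m ∂m := by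
  rw [lintegral_target _ (by fun_prop)]
  refine lintegral_congr fun θ => ?_
  simp only [← lintegral_const_mul' _ _ ENNReal.coe_ne_top]
  rw [lintegral_lintegral_swap (Measurable.aemeasurable (by fun_prop))]
  refine lintegral_congr fun z => ?_
  simp only [lintegral_const_mul' _ _ ENNReal.coe_ne_top]
  rw [M.lintegral_Q₁ N (θ, z) (F := fun p => F ((θ, z), p)) (by fun_prop),
    ← lintegral_const_mul' _ _ ENNReal.coe_ne_top]
  exact lintegral_congr fun η => mul_left_comm _ _ _

/-- In `F` the start of the `Q₂` move occupies the second slot, so `θ`, `η` keep the meaning they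
have in `lintegral_target_Q₁` and the two formulas can be compared pointwise. -/
lemma lintegral_target_Q₂ [SFinite m] [SFinite ν] (b : Fin (T + 1) → Fin N)
    {F : (Θ × Z) × (Θ × Z) × (Fin (T + 1) → Fin N → Z) → ℝ≥0∞} (hF : Measurable F) :
    ∫⁻ y, ∫⁻ p, F (p.1, y, p.2) ∂(M.Q₂ N b y) ∂M.target =
      ∫⁻ θ, ∫⁻ η, M.qDens η θ * ∫⁻ z', M.dens η z' * ∫⁻ u, ∫⁻ z, ∫⁻ ζ, F ((θ, z), (η, z'), ζ)
        ∂(M.csmc N b ((θ, η, z), u)) ∂(M.R₀ (θ, u 0)) ∂(M.reversedPath (η, θ, z')) ∂ν ∂m ∂m := by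
  rw [lintegral_lintegral_swap (Measurable.aemeasurable (by fun_prop)),
    lintegral_target _ (by fun_prop)]
  refine lintegral_congr fun η => ?_
  simp only [← lintegral_const_mul' _ _ ENNReal.coe_ne_top]
  rw [lintegral_lintegral_swap (Measurable.aemeasurable (by fun_prop))]
  refine lintegral_congr fun z' => ?_
  simp only [lintegral_const_mul' _ _ ENNReal.coe_ne_top]
  rw [M.lintegral_Q₂ N b (η, z') (F := fun p => F (p.1, (η, z'), p.2)) (by fun_prop),
    ← lintegral_const_mul' _ _ ENNReal.coe_ne_top]
  exact lintegral_congr fun θ => mul_left_comm _ _ _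

lemma lintegral_Q₂Uniform (y : Θ × Z) (F : (Θ × Z) × (Fin (T + 1) → Fin N → Z) → ℝ≥0∞) :
    ∫⁻ p, F p ∂(M.Q₂Uniform N y) =
      ((N : ℝ≥0∞) ^ (T + 1))⁻¹ * ∑ b : Fin (T + 1) → Fin N, ∫⁻ p, F p ∂(M.Q₂ N b y) := by
  rw [Q₂Uniform, lintegral_mixture, Finset.mul_sum]

/-- The reversal of the mixture of conditional SMC proposals, in terms of the SMC proposal. -/
lemma lintegral_target_Q₂Uniform [SFinite m] [SFinite ν]
    {F : (Θ × Z) × (Θ × Z) × (Fin (T + 1) → Fin N → Z) → ℝ≥0∞} (hF : Measurable F) :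
    ∫⁻ y, ∫⁻ p, F (p.1, y, p.2) ∂(M.Q₂Uniform N y) ∂M.target =
      ∫⁻ θ, ∫⁻ η, M.qDens η θ * ∫⁻ z, M.dens θ z * ∫⁻ ζ, M.estimate θ η ζ *
        ∫⁻ z', F ((θ, z), (η, z'), ζ) ∂(M.finalMove N ((θ, η, z), ζ)) ∂(M.smc N (θ, η, z))
        ∂ν ∂m ∂m := by
  simp only [lintegral_Q₂Uniform]
  rw [lintegral_const_mul _ (by fun_prop), lintegral_finsetSum _ (by fun_prop)]
  simp only [M.lintegral_target_Q₂ N _ hF]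
  rw [← lintegral_finsetSum _ (by fun_prop), ← lintegral_const_mul _ (by fun_prop)]
  refine lintegral_congr fun θ => ?_
  rw [← lintegral_finsetSum _ (by fun_prop), ← lintegral_const_mul _ (by fun_prop)]
  refine lintegral_congr fun η => ?_
  rw [M.lintegral_smc_estimate N θ η (F := fun p => F ((θ, p.1), (η, p.2.2), p.2.1))
    (by fun_prop), ← Finset.mul_sum, mul_left_comm]

/-- For such test functions all labellings give the same integral, hence each equals their average.
-/
lemma lintegral_Q₂_of_symmetric (b : Fin (T + 1) → Fin N) (y : Θ × Z)
    {F : (Θ × Z) × (Fin (T + 1) → Fin N → Z) → ℝ≥0∞} (hF : Measurable F)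
    (hsymm : ∀ (σ : Fin (T + 1) → Equiv.Perm (Fin N)) x ζ,
      F (x, fun t => ζ t ∘ σ t) = F (x, ζ)) :
    ∫⁻ p, F p ∂(M.Q₂ N b y) = ∫⁻ p, F p ∂(M.Q₂Uniform N y) := by
  have h : ∀ b', ∫⁻ p, F p ∂(M.Q₂ N b' y) = ∫⁻ p, F p ∂(M.Q₂ N b y) := fun b' => by
    rw [lintegral_Q₂ _ _ _ _ hF, lintegral_Q₂ _ _ _ _ hF]
    simp only [fun θ z p => M.lintegral_csmc_of_symmetric N b' b p
      (F := fun ζ => F ((θ, z), ζ)) (by fun_prop) fun σ ζ => hsymm σ (θ, z) ζ]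
  rw [lintegral_Q₂Uniform]
  simp only [h, Finset.sum_const, Finset.card_univ, Fintype.card_fun, Fintype.card_fin,
    nsmul_eq_mul, Nat.cast_pow]
  rw [← mul_assoc, ENNReal.inv_mul_cancel (by simp [NeZero.ne N]) (by simp), one_mul]

/-- The accepted moves of the two updates are the reversals of each other. -/
theorem lintegral_accepted [SFinite m] [SFinite ν] {g : (Θ × Z) × (Θ × Z) → ℝ≥0∞}
    (hg : Measurable g) (b : Fin (T + 1) → Fin N) :
    ∫⁻ x, ∫⁻ p, g (x, p.1) * min 1 (M.ratio x.1 p.1.1 p.2) ∂(M.Q₁ N x) ∂M.target =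
      ∫⁻ y, ∫⁻ p, g (p.1, y) * min 1 (1 / M.ratio p.1.1 y.1 p.2) ∂(M.Q₂ N b y) ∂M.target := by
  have hsymm : ∀ y : Θ × Z, _ := fun y => M.lintegral_Q₂_of_symmetric N b y
    (F := fun p => g (p.1, y) * min 1 (1 / M.ratio p.1.1 y.1 p.2)) (by fun_prop)
    fun σ x ζ => by simp only [ratio, estimate_comp_perm]
  simp only [hsymm]
  rw [M.lintegral_target_Q₁ N
      (F := fun p => g (p.1, p.2.1) * min 1 (M.ratio p.1.1 p.2.1.1 p.2.2)) (by fun_prop),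
    M.lintegral_target_Q₂Uniform N
      (F := fun p => g (p.1, p.2.1) * min 1 (1 / M.ratio p.1.1 p.2.1.1 p.2.2)) (by fun_prop)]
  refine lintegral_congr fun θ => lintegral_congr fun η => ?_
  rw [← lintegral_const_mul _ (by fun_prop), ← lintegral_const_mul _ (by fun_prop)]
  refine lintegral_congr fun z => ?_
  rw [mul_left_comm, mul_left_comm (M.qDens η θ : ℝ≥0∞)]
  congr 1
  rw [← lintegral_const_mul _ (by fun_prop), ← lintegral_const_mul _ (by fun_prop)]
  refine lintegral_congr fun ζ => ?_
  dsimp only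
  -- Acceptance does not depend on `z'`, so it leaves the innermost integral and the identity
  -- becomes `metropolis_balance`.
  rw [lintegral_mul_const _ (by fun_prop), lintegral_mul_const _ (by fun_prop), mul_left_comm,
    ratio, ← metropolis_balance _ _ (M.estimate_ne_top N θ η ζ)]
  ring

end AnnealedModel

end ParticleAIS

/-! ### Detailed balance and the acceptance ratio. -/

theorem mainTheorem12 {Θ Z : Type*} [MeasurableSpace Θ] [MeasurableSpace Z]
    (m : Measure Θ) [SigmaFinite m] (ν : Measure Z) [SigmaFinite ν]
    (T : ℕ) (M : ParticleAIS.AnnealedModel m ν T) (N : ℕ) [NeZero N] :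
    (M.transition N).IsReversible M.target ∧
    ((M.target ⊗ₘ M.Q₂Uniform N).map
        (fun p => (p.2.1, p.1, p.2.2))).restrict (M.proposable N) =
      ((M.target ⊗ₘ M.Q₁ N).restrict (M.proposable N)).withDensity
        (fun p => M.ratio p.1.1 p.2.1.1 p.2.2) := by
  have : SFinite M.target := by unfold ParticleAIS.AnnealedModel.target; infer_instance
  constructor
  · have happly : ∀ x A, M.transition N x A =
        2⁻¹ * M.update₁ N x A + 2⁻¹ * M.update₂ N x A := fun x A => by
      change (∑ j : Fin 2, (2 : ℝ≥0∞)⁻¹ •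
        (![M.update₁ N, M.update₂ N] : Fin 2 → Kernel _ _) j x) A = _
      simp [Fin.sum_univ_two]
    intro A B hA hB
    have hA1 : Measurable (A.indicator (1 : Θ × Z → ℝ≥0∞)) := measurable_one.indicator hA
    have hB1 : Measurable (B.indicator (1 : Θ × Z → ℝ≥0∞)) := measurable_one.indicator hB
    simp only [happly]
    have hm : ∀ C : Set (Θ × Z), MeasurableSet C →
        (Measurable fun x => M.update₁ N x C) ∧ Measurable fun x => M.update₂ N x C :=
      fun C hC => ⟨Kernel.measurable_coe _ hC, Kernel.measurable_coe _ hC⟩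
    rw [lintegral_add_left ((hm B hB).1.const_mul _), lintegral_add_left ((hm A hA).1.const_mul _),
      lintegral_const_mul _ (hm B hB).1, lintegral_const_mul _ (hm A hA).1,
      lintegral_const_mul _ (hm B hB).2, lintegral_const_mul _ (hm A hA).2, ← mul_add, ← mul_add]
    congr 1
    simp only [ParticleAIS.AnnealedModel.update₁, ParticleAIS.AnnealedModel.update₂]
    -- Accepted moves of the first update from `A` to `B` match those of the second from `B` to `A`,
    -- and conversely; the two updates balance each other rather than separately.
    rw [ParticleAIS.setLIntegral_acceptReject _ _ _ _ hA hB,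
      ParticleAIS.setLIntegral_acceptReject _ _ _ _ hA hB,
      ParticleAIS.setLIntegral_acceptReject _ _ _ _ hB hA,
      ParticleAIS.setLIntegral_acceptReject _ _ _ _ hB hA,
      M.lintegral_accepted N
        (g := fun p : (Θ × Z) × (Θ × Z) => A.indicator 1 p.1 * B.indicator 1 p.2) (by fun_prop)
        (fun _ => 0),
      M.lintegral_accepted N
        (g := fun p : (Θ × Z) × (Θ × Z) => B.indicator 1 p.1 * A.indicator 1 p.2) (by fun_prop)
        (fun _ => 0), Set.inter_comm B A]
    simp only [mul_comm (A.indicator (1 : Θ × Z → ℝ≥0∞) _)]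
    ring
  · have hS : MeasurableSet (M.proposable N) := by
      refine MeasurableSet.inter (s₁ := {p : (Θ × Z) × (Θ × Z) × (Fin (T + 1) → Fin N → Z) |
        M.qDens p.1.1 p.2.1.1 ≠ 0}) ?_ ?_ <;>
      exact (measurableSet_eq_fun (by fun_prop) measurable_const).compl
    refine Measure.ext_of_lintegral _ fun F hF => ?_
    have hFS : Measurable ((M.proposable N).indicator F) := hF.indicator hS
    rw [lintegral_withDensity_eq_lintegral_mul _ (by fun_prop) hF, ← lintegral_indicator hS,
      ← lintegral_indicator hS, lintegral_map hFS (by fun_prop),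
      Measure.lintegral_compProd (by fun_prop),
      Measure.lintegral_compProd ((Measurable.mul (by fun_prop) hF).indicator hS),
      M.lintegral_target_Q₂Uniform N hFS,
      M.lintegral_target_Q₁ N ((Measurable.mul (by fun_prop) hF).indicator hS)]
    refine lintegral_congr fun θ => lintegral_congr fun η => ?_
    by_cases h : M.qDens θ η ≠ 0 ∧ M.qDens η θ ≠ 0
    · have hmem : ∀ z z' (ζ : Fin (T + 1) → Fin N → Z),
        ((θ, z), (η, z'), ζ) ∈ M.proposable N := fun _ _ _ => h
      simp only [Set.indicator_of_mem (hmem _ _ _), Pi.mul_apply]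
      rw [← lintegral_const_mul _ (by fun_prop), ← lintegral_const_mul _ (by fun_prop)]
      refine lintegral_congr fun z => ?_
      rw [mul_left_comm, mul_left_comm (M.qDens θ η : ℝ≥0∞)]
      congr 1
      rw [← lintegral_const_mul _ (by fun_prop), ← lintegral_const_mul _ (by fun_prop)]
      refine lintegral_congr fun ζ => ?_
      -- Positivity of `q(θ, θ')` is what allows the cancellation of the denominator of the ratio.
      rw [lintegral_const_mul _ (by fun_prop), ← mul_assoc, ← mul_assoc,
        ParticleAIS.AnnealedModel.ratio,
        ← mul_assoc, ENNReal.mul_div_cancel (by simpa using h.1) ENNReal.coe_ne_top]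
    · have hmem : ∀ z z' (ζ : Fin (T + 1) → Fin N → Z),
        ((θ, z), (η, z'), ζ) ∉ M.proposable N := fun _ _ _ => h
      simp [Set.indicator_of_notMem (hmem _ _ _)]
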